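/- Let $X$ be a locally compact Polish space, let $C_b(X)$ be the space of bounded continuous functions $X\to\mathbb R$ and $C_0(X)\subseteq C_b(X)$ the subspace of functions vanishing at infinity, with the supremum norm $\|\cdot\|$. The strict topology $\beta$ on $C_b(X)$ is the locally convex topology generated by the seminorms $f\mapsto\sup_n a_n\sup_{x\in K_n}|f(x)|$, where $(K_n)$ ranges over the sequences of compact subsets of $X$ and $(a_n)$ over the sequences of non-negative reals converging to $0$. A strongly continuous semigroup on a locally convex space $E$ is a family $(T(t))_{t\ge 0}$ of continuous linear operators on $E$ with $T(0)=I$, $T(t)T(s)=T(t+s)$ for all $s,t\ge0$, and $t\mapsto T(t)f$ continuous on $[0,\infty)$ for every $f\in E$. It is SCLE if moreover for every $t\ge0$ and every continuous seminorm $p$ there is a continuous seminorm $q$ with $\sup_{s\le t}p(T(s)f)\le q(f)$ for all $f\in E$. Its generator is the set of all pairs $(f,g)\in E\times E$ with $g=\lim_{t\downarrow0}(T(t)f-f)/t$ in $E$. (1) Let $(S(t))_{t\ge0}$ be an SCLE semigroup on $(C_b(X),\beta)$ with $S(t)C_0(X)\subseteq C_0(X)$ for all $t\ge0$. Then its restriction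 $(\tilde S(t))_{t\ge0}$ to $C_0(X)$ is a strongly continuous semigroup on $(C_0(X),\|\cdot\|)$. (2) Conversely, let $(\tilde S(t))_{t\ge0}$ be a strongly continuous semigroup on $(C_0(X),\|\cdot\|)$ such that for every $t\ge 0$ the adjoint $\tilde S'(t)$ maps Borel probability measures on $X$ (viewed as elements of the dual of $C_0(X)$) to Borel probability measures. Then there is exactly one SCLE semigroup $(S(t))_{t\ge0}$ on $(C_b(X),\beta)$ with $S(t)f=\tilde S(t)f$ for all $t\ge0$ and $f\in C_0(X)$. (3) Let $(S(t))_{t\ge0}$ be an SCLE semigroup on $(C_b(X),\beta)$ that extends a strongly continuous semigroup $(\tilde S(t))_{t\ge0}$ on $(C_0(X),\|\cdot\|)$ (as in (1) or in (2)), and let $A$ and $\tilde A$ be their generators. Then $\tilde A\subseteq A$, and $A$ is the closure of $\tilde A$ in $C_b(X)\times C_b(X)$ for the product topology $\beta\times\beta$. -/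

import Mathlib

open Filter Topology MeasureTheory Set
open scoped NNReal BoundedContinuousFunction ZeroAtInfty

/-- The space `C_b(X)` of bounded continuous real functions, to be equipped with the strict
topology instead of the norm topology. -/
def StrictCb (X : Type*) [TopologicalSpace X] : Type _ := X →ᵇ ℝ

namespace StrictCb

variable {X : Type*} [TopologicalSpace X]

noncomputable instance : AddCommGroup (StrictCb X) := inferInstanceAs (AddCommGroup (X →ᵇ ℝ))

noncomputable instance : Module ℝ (StrictCb X) := inferInstanceAs (Module ℝ (X →ᵇ ℝ))

/-- The identity, as a linear equivalence between `C_b(X)` and its copy with the strict topology. -/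
noncomputable def of : (X →ᵇ ℝ) ≃ₗ[ℝ] StrictCb X := LinearEquiv.refl ℝ (X →ᵇ ℝ)

noncomputable instance : CoeFun (StrictCb X) (fun _ => X → ℝ) := ⟨fun f => (of.symm f : X →ᵇ ℝ)⟩

@[simp] theorem add_apply (f g : StrictCb X) (x : X) : (f + g) x = f x + g x := rfl

@[simp] theorem smul_apply (c : ℝ) (f : StrictCb X) (x : X) : (c • f) x = c * f x := rfl

@[simp] theorem of_apply (f : X →ᵇ ℝ) (x : X) : (of f) x = f x := rfl

theorem abs_apply_le (f : StrictCb X) (x : X) : |f x| ≤ ‖of.symm f‖ :=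
  (of.symm f).norm_coe_le_norm x

/-- The index set of the strict seminorms: sequences of compact sets `K n` together with
sequences of weights `a n ≥ 0` converging to `0`. -/
abbrev Index (X : Type*) [TopologicalSpace X] : Type _ :=
  (ℕ → TopologicalSpace.Compacts X) × {a : ℕ → ℝ≥0 // Tendsto a atTop (𝓝 0)}

instance : Nonempty (Index X) := ⟨(fun _ => ⊥, ⟨fun _ => 0, tendsto_const_nhds⟩)⟩

/-- The value `sup_n a_n sup_{x ∈ K_n} |f x|`; the supremum over the empty set is `0`. -/
noncomputable def strictValue (i : Index X) (f : StrictCb X) : ℝ :=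
  ⨆ n : ℕ, (i.2.1 n : ℝ) * ⨆ x : (i.1 n : Set X), |f x|

theorem bddAbove_inner (K : Set X) (f : StrictCb X) :
    BddAbove (range fun x : K => |f x|) :=
  ⟨‖of.symm f‖, by rintro _ ⟨x, rfl⟩; exact abs_apply_le f x⟩

theorem inner_nonneg (K : Set X) (f : StrictCb X) : 0 ≤ ⨆ x : K, |f x| :=
  Real.iSup_nonneg fun _ => abs_nonneg _

theorem bddAbove_outer (i : Index X) (f : StrictCb X) :
    BddAbove (range fun n : ℕ => (i.2.1 n : ℝ) * ⨆ x : (i.1 n : Set X), |f x|) := by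
  obtain ⟨C, hC⟩ := i.2.2.bddAbove_range
  refine ⟨(C : ℝ) * ‖of.symm f‖, ?_⟩
  rintro _ ⟨n, rfl⟩
  have h1 : (i.2.1 n : ℝ) ≤ C := by exact_mod_cast hC ⟨n, rfl⟩
  exact mul_le_mul h1 (Real.iSup_le (fun x => abs_apply_le f x) (norm_nonneg _))
    (inner_nonneg _ _) C.2

/-- The seminorm `p_{K,a}(f) = sup_n a_n sup_{x ∈ K_n} |f x|`. -/
noncomputable def strictSeminorm (i : Index X) : Seminorm ℝ (StrictCb X) :=
  Seminorm.of (strictValue i)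
    (by
      intro f g
      refine ciSup_le fun n => ?_
      have h : (⨆ x : (i.1 n : Set X), |(f + g) x|)
          ≤ (⨆ x : (i.1 n : Set X), |f x|) + ⨆ x : (i.1 n : Set X), |g x| := by
        refine Real.iSup_le (fun x => ?_) (add_nonneg (inner_nonneg _ _) (inner_nonneg _ _))
        exact (abs_add_le (f x) (g x)).trans
          (add_le_add (le_ciSup (bddAbove_inner _ f) x) (le_ciSup (bddAbove_inner _ g) x))
      calc _ ≤ (i.2.1 n : ℝ) * ((⨆ x : (i.1 n : Set X), |f x|)
                + ⨆ x : (i.1 n : Set X), |g x|) :=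
            mul_le_mul_of_nonneg_left h (i.2.1 n).2
        _ = (i.2.1 n : ℝ) * (⨆ x : (i.1 n : Set X), |f x|)
              + (i.2.1 n : ℝ) * ⨆ x : (i.1 n : Set X), |g x| := mul_add _ _ _
        _ ≤ strictValue i f + strictValue i g :=
            add_le_add (le_ciSup (bddAbove_outer i f) n) (le_ciSup (bddAbove_outer i g) n))
    (by
      intro c f
      simp only [strictValue, smul_apply, abs_mul, Real.norm_eq_abs,
        Real.mul_iSup_of_nonneg (abs_nonneg c)]
      congr 1
      funext n
      rw [← Real.mul_iSup_of_nonneg (abs_nonneg c)]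
      ring)

theorem strictSeminorm_apply (i : Index X) (f : StrictCb X) :
    strictSeminorm i f = ⨆ n : ℕ, (i.2.1 n : ℝ) * ⨆ x : (i.1 n : Set X), |f x| := rfl

/-- The family of seminorms that generates the strict topology. -/
noncomputable def strictFamily (X : Type*) [TopologicalSpace X] :
    SeminormFamily ℝ (StrictCb X) (Index X) := strictSeminorm

/-- The strict topology: the locally convex topology generated by the seminorms `p_{K,a}`. -/
noncomputable instance : TopologicalSpace (StrictCb X) :=
  (strictFamily X).moduleFilterBasis.topology

theorem withSeminorms_strict : WithSeminorms (strictFamily X) := ⟨rfl⟩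

instance : IsTopologicalAddGroup (StrictCb X) := withSeminorms_strict.topologicalAddGroup

instance : ContinuousSMul ℝ (StrictCb X) := withSeminorms_strict.continuousSMul

instance : LocallyConvexSpace ℝ (StrictCb X) := withSeminorms_strict.toLocallyConvexSpace

/-- The inclusion of `C_0(X)` in `C_b(X)`. -/
noncomputable def ofC0 : C₀(X, ℝ) →ₗ[ℝ] StrictCb X where
  toFun f := of f.toBCF
  map_add' _ _ := rfl
  map_smul' _ _ := rfl

@[simp] theorem ofC0_apply (f : C₀(X, ℝ)) (x : X) : (ofC0 f) x = f x := rfl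

end StrictCb

section Semigroups

variable {E : Type*} [AddCommGroup E] [Module ℝ E] [TopologicalSpace E]

/-- A strongly continuous one-parameter semigroup of continuous linear operators. -/
structure IsStronglyContinuousSemigroup (T : ℝ≥0 → E →L[ℝ] E) : Prop where
  map_zero : T 0 = ContinuousLinearMap.id ℝ E
  map_add : ∀ s t : ℝ≥0, (T t).comp (T s) = T (t + s)
  continuous_orbit : ∀ f : E, Continuous fun t : ℝ≥0 => T t f

/-- Local equi-continuity: for every `t` and every continuous seminorm `p` there is a continuous
seminorm `q` with `sup_{s ≤ t} p (T s f) ≤ q f` for all `f`. -/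
def IsLocallyEquicontinuous (T : ℝ≥0 → E →L[ℝ] E) : Prop :=
  ∀ (t : ℝ≥0) (p : Seminorm ℝ E), Continuous p →
    ∃ q : Seminorm ℝ E, Continuous q ∧ ∀ s ≤ t, ∀ f : E, p (T s f) ≤ q f

/-- A strongly continuous and locally equi-continuous semigroup. -/
structure IsSCLE (T : ℝ≥0 → E →L[ℝ] E) : Prop where
  stronglyContinuous : IsStronglyContinuousSemigroup T
  locallyEquicontinuous : IsLocallyEquicontinuous T

/-- The graph of the generator of `T`: all `(f, g)` such that `(T t f - f) / t` converges to `g`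
as `t` decreases to `0`. -/
def generator (T : ℝ≥0 → E →L[ℝ] E) : Set (E × E) :=
  {z | Tendsto (fun t : ℝ≥0 => (t : ℝ)⁻¹ • (T t z.1 - z.1)) (𝓝[>] 0) (𝓝 z.2)}

end Semigroups

section C0

variable {X : Type*} [TopologicalSpace X]

/-- The probability measures on `X`, seen as elements of the dual of `C_0(X)`. -/
def probabilityFunctionals (X : Type*) [TopologicalSpace X] [MeasurableSpace X] :
    Set (StrongDual ℝ C₀(X, ℝ)) :=
  {φ | ∃ μ : ProbabilityMeasure X, ∀ f : C₀(X, ℝ), φ f = ∫ x, f x ∂(μ : Measure X)}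

/-- The adjoint operators `φ ↦ φ ∘ T t` map probability measures to probability measures. -/
def AdjointPreservesProbability [MeasurableSpace X] (T : ℝ≥0 → C₀(X, ℝ) →L[ℝ] C₀(X, ℝ)) : Prop :=
  ∀ t : ℝ≥0, MapsTo (fun φ : StrongDual ℝ C₀(X, ℝ) => φ.comp (T t))
    (probabilityFunctionals X) (probabilityFunctionals X)

/-- `S` on `C_b(X)` extends `T` on `C_0(X)`; equivalently `T` is the restriction of `S`. -/
def Extends (S : ℝ≥0 → StrictCb X →L[ℝ] StrictCb X)
    (T : ℝ≥0 → C₀(X, ℝ) →L[ℝ] C₀(X, ℝ)) : Prop :=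
  ∀ (t : ℝ≥0) (f : C₀(X, ℝ)), S t (StrictCb.ofC0 f) = StrictCb.ofC0 (T t f)

/-- The graph of the generator of `T` on `C_0(X)`, as a subset of `C_b(X) × C_b(X)`. -/
def c0Generator (T : ℝ≥0 → C₀(X, ℝ) →L[ℝ] C₀(X, ℝ)) : Set (StrictCb X × StrictCb X) :=
  Prod.map StrictCb.ofC0 StrictCb.ofC0 '' generator T

end C0

/-! Three facts about the strict topology carry the proof: strictly bounded families are norm
bounded (`exists_norm_le_of_forall_seminorm`), `C_0(X)` is strictly dense (`denseRange_ofC0`), and a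
norm-bounded, uniformly tight family of seminorms is strictly equicontinuous
(`exists_continuous_seminorm_ge`).

Restriction: local equicontinuity bounds the norms of `S(s)` for `s ≤ t`, so only norm continuity at
`0` is at issue. The vectors of `C_0(X)` having it form a closed subspace, which contains every `∫₀ᵗ
S(s)f ds`. Functionals on `C_0(X)` are tight, hence strictly continuous on norm-bounded sets; so
`t⁻¹ ∫₀ᵗ S(s)f ds → f` weakly, and by Hahn–Banach the subspace is everything.

Extension: the adjoint sends the Dirac measure at `x` to a probability measure `P(t,x)`, and
`S(t)f(x) = ∫ f dP(t,x)`. Vague continuity in `(t,x)` without loss of mass forces tightness on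
compact sets, which yields continuity of `S(t)f` and local equicontinuity. Density gives uniqueness
and the semigroup law.

Generators: `(f,g)` lies in `A` iff `S(t)f - f = ∫₀ᵗ S(s)g ds` for all `t`, so `A` is closed.
Conversely the pairs `(∫₀ᵗ S(s)f ds, S(t)f - f)` lie in the smaller generator for `f` in `C_0(X)`,
hence in its closure for every `f` by density; dividing by `t` and letting `t → 0` reaches all of
`A`. -/

namespace StrictCb

/-! ### Strict seminorms compared with the supremum norm -/

section Basic

variable {X : Type*} [TopologicalSpace X]

@[ext] theorem ext {f g : StrictCb X} (h : ∀ x, f x = g x) : f = g :=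
  BoundedContinuousFunction.ext h

@[simp] theorem sub_apply (f g : StrictCb X) (x : X) : (f - g) x = f x - g x := rfl

theorem continuous_coe (f : StrictCb X) : Continuous f := (of.symm f : X →ᵇ ℝ).continuous

theorem norm_le {f : StrictCb X} {C : ℝ} (hC : 0 ≤ C) (h : ∀ x, |f x| ≤ C) : ‖of.symm f‖ ≤ C :=
  (BoundedContinuousFunction.norm_le hC).2 h

theorem norm_ofC0 (f : C₀(X, ℝ)) : ‖of.symm (ofC0 f)‖ = ‖f‖ := rfl

theorem ofC0_injective : Function.Injective (ofC0 : C₀(X, ℝ) →ₗ[ℝ] StrictCb X) := fun f g h => by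
  ext x
  rw [← ofC0_apply, h, ofC0_apply]

theorem le_strictSeminorm (i : Index X) (f : StrictCb X) (n : ℕ) {x : X}
    (hx : x ∈ (i.1 n : Set X)) : (i.2.1 n : ℝ) * |f x| ≤ strictSeminorm i f :=
  (mul_le_mul_of_nonneg_left (le_ciSup (bddAbove_inner _ f) ⟨x, hx⟩) (i.2.1 n).2).trans
    (le_ciSup (bddAbove_outer i f) n)

theorem strictSeminorm_le {i : Index X} {f : StrictCb X} {C : ℝ} (hC : 0 ≤ C)
    (h : ∀ n, ∀ x ∈ (i.1 n : Set X), (i.2.1 n : ℝ) * |f x| ≤ C) : strictSeminorm i f ≤ C := by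
  refine Real.iSup_le (fun n => ?_) hC
  have hn : 0 ≤ ((i.2.1 n : ℝ≥0) : ℝ) := (i.2.1 n).2
  exact (Real.mul_iSup_of_nonneg hn _).trans_le (Real.iSup_le (fun x => h n x x.2) hC)

theorem continuous_strictSeminorm (i : Index X) : Continuous (strictSeminorm i) :=
  withSeminorms_strict.continuous_seminorm i

theorem exists_strictSeminorm_le_norm (i : Index X) :
    ∃ C : ℝ, 0 ≤ C ∧ ∀ f : StrictCb X, strictSeminorm i f ≤ C * ‖of.symm f‖ := by
  obtain ⟨C, hC⟩ := i.2.2.bddAbove_range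
  refine ⟨C, C.2, fun f => strictSeminorm_le (by positivity) fun n x _ => ?_⟩
  have h1 : (i.2.1 n : ℝ) ≤ C := by exact_mod_cast hC ⟨n, rfl⟩
  exact mul_le_mul h1 (abs_apply_le f x) (abs_nonneg _) C.2

/-- The identity from the norm topology to the strict topology. -/
noncomputable def ofL : (X →ᵇ ℝ) →L[ℝ] StrictCb X where
  toLinearMap := (of : (X →ᵇ ℝ) ≃ₗ[ℝ] StrictCb X).toLinearMap
  cont := by
    refine withSeminorms_strict.continuous_of_continuous_comp _ fun i => ?_
    obtain ⟨C, hC, h⟩ := exists_strictSeminorm_le_norm i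
    exact Seminorm.continuous_of_le (q := C.toNNReal • normSeminorm ℝ (X →ᵇ ℝ))
      (by
        have : Continuous fun f : X →ᵇ ℝ => (C.toNNReal : ℝ) * ‖f‖ := by fun_prop
        exact this)
      (fun f => by
        have h2 := h (of f)
        simp only [LinearEquiv.symm_apply_apply] at h2
        have : (C.toNNReal • normSeminorm ℝ (X →ᵇ ℝ)) f = C * ‖f‖ := by
          rw [_root_.smul_apply, NNReal.smul_def, Real.coe_toNNReal _ hC]; rfl
        rw [this]; exact h2)

theorem continuous_ofC0 : Continuous (ofC0 : C₀(X, ℝ) →ₗ[ℝ] StrictCb X) :=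
  ofL.continuous.comp ZeroAtInftyContinuousMap.isometry_toBCF.continuous

theorem exists_le_norm_of_continuous (p : Seminorm ℝ (StrictCb X)) (hp : Continuous p) :
    ∃ C : ℝ, 0 ≤ C ∧ ∀ f : StrictCb X, p f ≤ C * ‖of.symm f‖ := by
  obtain ⟨C, hC, h⟩ := Seminorm.bound_of_continuous_normedSpace (p.comp ofL.toLinearMap)
    (hp.comp ofL.continuous)
  exact ⟨C, hC.le, fun f => h (of.symm f)⟩

theorem tendsto_iff_seminorm {α : Type*} {l : Filter α} {u : α → StrictCb X} {f : StrictCb X} :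
    Tendsto u l (𝓝 f) ↔ ∀ p : Seminorm ℝ (StrictCb X), Continuous p →
      Tendsto (fun a => p (u a - f)) l (𝓝 0) := by
  constructor
  · intro h p hp
    have : Tendsto (fun a => p (u a - f)) l (𝓝 (p (f - f))) :=
      (hp.tendsto _).comp (h.sub_const f)
    simpa using this
  · intro h
    rw [withSeminorms_strict.tendsto_nhds]
    intro i ε hε
    exact (h _ (continuous_strictSeminorm i)).eventually (gt_mem_nhds hε)

/-- The index of the seminorm `f ↦ sup_K |f|`. -/
noncomputable def compactIndex (K : TopologicalSpace.Compacts X) : Index X :=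
  (fun _ => K, ⟨fun n => if n = 0 then 1 else 0,
    tendsto_const_nhds.congr' (by
      filter_upwards [eventually_ge_atTop 1] with n hn
      rw [if_neg (by omega)])⟩)

theorem abs_le_compactIndex (K : TopologicalSpace.Compacts X) (f : StrictCb X) {x : X}
    (hx : x ∈ K) : |f x| ≤ strictSeminorm (compactIndex K) f := by
  simpa [compactIndex] using le_strictSeminorm (compactIndex K) f 0 hx

/-- Evaluation at a point. -/
noncomputable def evalL (x : X) : StrictCb X →L[ℝ] ℝ where
  toFun f := f x
  map_add' _ _ := rfl
  map_smul' _ _ := rfl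
  cont := by
    rw [continuous_iff_continuousAt]
    intro f
    let K : TopologicalSpace.Compacts X := ⟨{x}, isCompact_singleton⟩
    have h := tendsto_iff_seminorm.1 (tendsto_id (x := 𝓝 f)) _
      (continuous_strictSeminorm (compactIndex K))
    refine tendsto_iff_dist_tendsto_zero.2 (squeeze_zero (fun _ => dist_nonneg) (fun g => ?_) h)
    exact abs_le_compactIndex K (g - f) (mem_singleton x)

@[simp] theorem evalL_apply (x : X) (f : StrictCb X) : evalL x f = f x := rfl

instance : T2Space (StrictCb X) := by
  have : T1Space (StrictCb X) := by
    refine withSeminorms_strict.T1_of_separating fun f hf => ?_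
    obtain ⟨x, hx⟩ : ∃ x, f x ≠ 0 := by
      by_contra! h
      exact hf (ext h)
    let K : TopologicalSpace.Compacts X := ⟨{x}, isCompact_singleton⟩
    exact ⟨compactIndex K,
      ((abs_pos.2 hx).trans_le (abs_le_compactIndex K f (mem_singleton x))).ne'⟩
  infer_instance

/-- Strictly bounded families are bounded in norm. -/
theorem exists_norm_le_of_forall_seminorm {ι : Type*} (F : ι → StrictCb X)
    (h : ∀ i : Index X, ∃ C : ℝ, ∀ j, strictSeminorm i (F j) ≤ C) :
    ∃ M : ℝ, 0 ≤ M ∧ ∀ j, ‖of.symm (F j)‖ ≤ M := by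
  by_contra! hM
  have hx : ∀ n : ℕ, ∃ j x, ((n : ℝ) + 1) ^ 2 < |F j x| := fun n => by
    obtain ⟨j, hj⟩ := hM (((n : ℝ) + 1) ^ 2) (by positivity)
    by_contra! hn
    exact hj.not_ge (norm_le (by positivity) (hn j))
  choose j x hx using hx
  -- The weights `1/(n+1)` tend to zero, but the values at `x n` exceed `(n+1)^2`, so this single
  -- seminorm is unbounded on the family.
  let i : Index X := (fun n => ⟨{x n}, isCompact_singleton⟩,
    ⟨fun n => 1 / ((n : ℝ≥0) + 1), tendsto_one_div_add_atTop_nhds_zero_nat⟩)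
  obtain ⟨C, hC⟩ := h i
  obtain ⟨n, hn⟩ := exists_nat_gt C
  have h1 := (le_strictSeminorm i (F (j n)) n (mem_singleton (x n))).trans (hC _)
  have h2 : (1 / ((n : ℝ) + 1)) * ((n : ℝ) + 1) ^ 2 ≤ (i.2.1 n : ℝ) * |F (j n) (x n)| := by
    have : (i.2.1 n : ℝ) = 1 / ((n : ℝ) + 1) := by simp [i]
    rw [this]
    exact mul_le_mul_of_nonneg_left (hx n).le (by positivity)
  have h3 : (1 / ((n : ℝ) + 1)) * ((n : ℝ) + 1) ^ 2 = (n : ℝ) + 1 := by field_simp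
  linarith

/-- Strict seminorms are tight: they are small on functions that vanish on a large compact set. -/
theorem exists_isCompact_strictSeminorm_le (i : Index X) {ε : ℝ} (hε : 0 < ε) :
    ∃ K : TopologicalSpace.Compacts X, ∃ C : ℝ, 0 ≤ C ∧ ∀ (f : StrictCb X) (δ : ℝ), 0 ≤ δ →
      (∀ x ∈ K, |f x| ≤ δ) → strictSeminorm i f ≤ C * δ + ε * ‖of.symm f‖ := by
  obtain ⟨N, hN⟩ := eventually_atTop.1
    (i.2.2.eventually (gt_mem_nhds (show (0 : ℝ≥0) < ⟨ε, hε.le⟩ from hε)))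
  obtain ⟨C, hC⟩ := i.2.2.bddAbove_range
  refine ⟨⟨⋃ n ∈ Finset.range N, (i.1 n : Set X),
    (Finset.range N).isCompact_biUnion fun n _ => (i.1 n).isCompact⟩, C, C.2,
    fun f δ hδ hf => strictSeminorm_le (by positivity) fun n x hx => ?_⟩
  rcases lt_or_ge n N with hn | hn
  · have h1 : (i.2.1 n : ℝ) ≤ C := by exact_mod_cast hC ⟨n, rfl⟩
    have h2 := hf x (mem_iUnion₂.2 ⟨n, Finset.mem_range.2 hn, hx⟩)
    have h3 := mul_le_mul h1 h2 (abs_nonneg _) C.2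
    have : 0 ≤ ε * ‖of.symm f‖ := by positivity
    linarith
  · have h1 : (i.2.1 n : ℝ) ≤ ε := (hN n hn).le
    have h3 := mul_le_mul h1 (abs_apply_le f x) (abs_nonneg _) hε.le
    have : 0 ≤ C * δ := mul_nonneg C.2 hδ
    linarith

end Basic

/-! ### Cutoff functions, density of `C_0(X)`, and the equicontinuity criterion -/

section Cutoff

variable {X : Type*} [TopologicalSpace X]

/-- The product of a function in `C_0(X)` and a function in `C_b(X)`. -/
noncomputable def cut (χ : C₀(X, ℝ)) (f : StrictCb X) : C₀(X, ℝ) where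
  toFun x := χ x * f x
  continuous_toFun := χ.continuous.mul f.continuous_coe
  zero_at_infty' := by
    refine squeeze_zero_norm (a := fun x => ‖χ x‖ * ‖of.symm f‖) (fun x => ?_) ?_
    · rw [norm_mul]
      exact mul_le_mul_of_nonneg_left (abs_apply_le f x) (norm_nonneg _)
    · simpa using (χ.zero_at_infty'.norm).mul_const ‖of.symm f‖

@[simp] theorem cut_apply (χ : C₀(X, ℝ)) (f : StrictCb X) (x : X) : cut χ f x = χ x * f x := rfl

/-- `χ` is a continuous function between `0` and `1` that is `1` on `K`. -/
structure IsCutoff (χ : C₀(X, ℝ)) (K : Set X) : Prop where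
  nonneg : ∀ x, 0 ≤ χ x
  le_one : ∀ x, χ x ≤ 1
  eq_one : ∀ x ∈ K, χ x = 1

theorem exists_isCutoff [T2Space X] [LocallyCompactSpace X] {K : Set X} (hK : IsCompact K) :
    ∃ χ : C₀(X, ℝ), IsCutoff χ K ∧ ∃ M : TopologicalSpace.Compacts X, ∀ x ∉ M, χ x = 0 := by
  obtain ⟨f, h1, -, hc, h01⟩ := exists_continuous_one_zero_of_isCompact hK isClosed_empty
    (disjoint_empty K)
  exact ⟨⟨f, hc.is_zero_at_infty⟩, ⟨fun x => (h01 x).1, fun x => (h01 x).2, fun x hx => h1 hx⟩,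
    ⟨_, hc⟩, fun x hx => image_eq_zero_of_notMem_tsupport hx⟩

theorem IsCutoff.abs_sub_cut_le {χ : C₀(X, ℝ)} {K : Set X} (h : IsCutoff χ K) (f : StrictCb X)
    (x : X) : |(f - ofC0 (cut χ f)) x| ≤ |f x| := by
  rw [sub_apply, ofC0_apply, cut_apply, show f x - χ x * f x = (1 - χ x) * f x by ring, abs_mul,
    abs_of_nonneg (sub_nonneg.2 (h.le_one x))]
  exact mul_le_of_le_one_left (abs_nonneg _) (by linarith [h.nonneg x])

theorem IsCutoff.norm_sub_cut_le {χ : C₀(X, ℝ)} {K : Set X} (h : IsCutoff χ K) (f : StrictCb X) :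
    ‖of.symm (f - ofC0 (cut χ f))‖ ≤ ‖of.symm f‖ :=
  norm_le (norm_nonneg _) fun x => (h.abs_sub_cut_le f x).trans (abs_apply_le f x)

theorem IsCutoff.sub_cut_eq_zero {χ : C₀(X, ℝ)} {K : Set X} (h : IsCutoff χ K) (f : StrictCb X)
    {x : X} (hx : x ∈ K) : (f - ofC0 (cut χ f)) x = 0 := by
  simp [h.eq_one x hx]

variable [T2Space X] [LocallyCompactSpace X]

/-- `C_0(X)` is strictly dense in `C_b(X)`. -/
theorem denseRange_ofC0 : DenseRange (ofC0 : C₀(X, ℝ) →ₗ[ℝ] StrictCb X) := by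
  intro f
  choose χ hχ _ _ using fun K : TopologicalSpace.Compacts X => exists_isCutoff K.isCompact
  refine mem_closure_of_tendsto (f := fun K => ofC0 (cut (χ K) f)) (b := atTop) ?_
    (Eventually.of_forall fun K => mem_range_self _)
  rw [withSeminorms_strict.tendsto_nhds]
  intro i ε hε
  have hpos : 0 < ε / (‖of.symm f‖ + 1) := by positivity
  obtain ⟨K, C, -, hK⟩ := exists_isCompact_strictSeminorm_le i hpos
  filter_upwards [eventually_ge_atTop K] with L hL
  have h1 := hK (f - ofC0 (cut (χ L) f)) 0 le_rfl fun x hx => by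
    rw [(hχ L).sub_cut_eq_zero f (hL hx), abs_zero]
  have h2 := mul_le_mul_of_nonneg_left ((hχ L).norm_sub_cut_le f) hpos.le
  have h3 : ε / (‖of.symm f‖ + 1) * ‖of.symm f‖ < ε := by
    rw [div_mul_eq_mul_div, div_lt_iff₀ (by positivity)]
    nlinarith
  rw [map_sub_rev]
  change strictSeminorm i _ < ε
  linarith

/-- A family of seminorms that is bounded by the norm and uniformly tight is equicontinuous for
the strict topology. -/
theorem exists_continuous_seminorm_ge {ι : Type*} (p : ι → Seminorm ℝ (StrictCb X)) {C : ℝ}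
    (hC : 0 ≤ C) (hp : ∀ i f, p i f ≤ C * ‖of.symm f‖)
    (ht : ∀ ε > 0, ∃ K : TopologicalSpace.Compacts X, ∀ i f, (∀ x ∈ K, f x = 0) →
      p i f ≤ ε * ‖of.symm f‖) :
    ∃ q : Seminorm ℝ (StrictCb X), Continuous q ∧ ∀ i, p i ≤ q := by
  -- The tightness errors `4^{-j}` have to beat the factor `2^j` lost when the sup over `N j` is
  -- bounded by a seminorm with weights `2^{-j}`; the product `2^{-j}` is summable.
  have h4 : ∀ j : ℕ, (0 : ℝ) < (1 / 4) ^ j := fun j => by positivity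
  choose K' hK' using fun j : ℕ => ht _ (h4 j)
  let K : ℕ → TopologicalSpace.Compacts X := fun j => (Finset.range (j + 1)).sup K'
  have hKmono : Monotone K := fun a b hab =>
    Finset.sup_mono (Finset.range_subset_range.2 (by omega))
  have hK : ∀ j i f, (∀ x ∈ K j, f x = 0) → p i f ≤ (1 / 4) ^ j * ‖of.symm f‖ :=
    fun j i f hf => hK' j i f fun x hx => hf x
      ((Finset.le_sup (f := K') (Finset.self_mem_range_succ j) : K' j ≤ K j) hx)
  choose χ hχ M hM using fun j => exists_isCutoff (K j).isCompact
  let N : ℕ → TopologicalSpace.Compacts X := fun j => M j ⊔ M (j + 1)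
  let ix : Index X := (N, ⟨fun j => (1 / 2) ^ j,
    NNReal.tendsto_pow_atTop_nhds_zero_of_lt_one (by norm_num)⟩)
  have hN : ∀ j f, ∀ x ∈ N j, |f x| ≤ 2 ^ j * strictSeminorm ix f := fun j f x hx => by
    have h := le_strictSeminorm ix f j hx
    have h2 : (ix.2.1 j : ℝ) = (1 / 2) ^ j := by simp [ix]
    rw [h2, one_div, inv_pow, inv_mul_le_iff₀ (by positivity)] at h
    exact h
  have hq0 : ∀ f, 0 ≤ strictSeminorm ix f := fun f => apply_nonneg _ _
  have hstart : ∀ i f, p i (ofC0 (cut (χ 0) f)) ≤ C * strictSeminorm ix f := fun i f => by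
    refine (hp i _).trans (mul_le_mul_of_nonneg_left (norm_le (hq0 f) fun x => ?_) hC)
    by_cases hx : x ∈ M 0
    · have h1 := hN 0 f x (le_sup_left (a := M 0) (b := M 1) hx)
      rw [ofC0_apply, cut_apply, abs_mul, abs_of_nonneg ((hχ 0).nonneg x)]
      rw [pow_zero, one_mul] at h1
      exact (mul_le_of_le_one_left (abs_nonneg _) ((hχ 0).le_one x)).trans h1
    · simp [hM 0 x hx, hq0 f]
  -- The increment of consecutive cutoffs is supported in `N j`, which bounds its norm by the
  -- seminorm, and vanishes on `K j`, which makes tightness applicable.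
  have hstep : ∀ j i f, p i (ofC0 (cut (χ (j + 1)) f) - ofC0 (cut (χ j) f))
      ≤ (1 / 2) ^ j * strictSeminorm ix f := fun j i f => by
    have h1 : ‖of.symm (ofC0 (cut (χ (j + 1)) f) - ofC0 (cut (χ j) f))‖
        ≤ 2 ^ j * strictSeminorm ix f := by
      refine norm_le (mul_nonneg (by positivity) (hq0 f)) fun x => ?_
      by_cases hx : x ∈ N j
      · refine le_trans ?_ (hN j f x hx)
        rw [sub_apply, ofC0_apply, ofC0_apply, cut_apply, cut_apply, ← sub_mul, abs_mul]
        refine mul_le_of_le_one_left (abs_nonneg _) (abs_le.2 ?_)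
        constructor <;> linarith [(hχ j).nonneg x, (hχ j).le_one x, (hχ (j + 1)).nonneg x,
          (hχ (j + 1)).le_one x]
      · have h2 : x ∉ M j := fun h => hx (le_sup_left (a := M j) (b := M (j + 1)) h)
        have h3 : x ∉ M (j + 1) := fun h => hx (le_sup_right (a := M j) (b := M (j + 1)) h)
        simp only [sub_apply, ofC0_apply, cut_apply, hM j x h2, hM (j + 1) x h3, zero_mul, sub_zero,
          abs_zero]
        exact mul_nonneg (by positivity) (hq0 f)
    refine (hK j i _ fun x hx => ?_).trans ((mul_le_mul_of_nonneg_left h1 (h4 j).le).trans_eq ?_)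
    · simp [(hχ j).eq_one x hx, (hχ (j + 1)).eq_one x (hKmono (Nat.le_succ j) hx)]
    · rw [← mul_assoc, ← mul_pow]; norm_num
  have hsum : ∀ n i f, p i (ofC0 (cut (χ n) f))
      ≤ (C + 2 - 2 * (1 / 2) ^ n) * strictSeminorm ix f := fun n i f => by
    induction n with
    | zero => simpa using hstart i f
    | succ n ih =>
      have h1 := map_add_le_add (p i) (ofC0 (cut (χ n) f))
        (ofC0 (cut (χ (n + 1)) f) - ofC0 (cut (χ n) f))
      rw [add_sub_cancel] at h1
      have h2 := hstep n i f
      have h3 : (C + 2 - 2 * (1 / 2) ^ (n + 1)) * strictSeminorm ix f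
        = (C + 2 - 2 * (1 / 2) ^ n) * strictSeminorm ix f
          + (1 / 2) ^ n * strictSeminorm ix f := by ring
      linarith
  refine ⟨(C + 2).toNNReal • strictSeminorm ix, ?_, fun i f => ?_⟩
  · have : Continuous fun f : StrictCb X => ((C + 2).toNNReal : ℝ) * strictSeminorm ix f :=
      (continuous_strictSeminorm ix).const_mul _
    exact this
  · have hq : ((C + 2).toNNReal • strictSeminorm ix) f = (C + 2) * strictSeminorm ix f := by
      rw [_root_.smul_apply, NNReal.smul_def, Real.coe_toNNReal _ (by linarith)]; rfl
    rw [hq]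
    -- The cut part is bounded by telescoping; the remainder vanishes on `K n`, and its contribution
    -- disappears as `n` grows.
    have hb : ∀ n : ℕ, p i f ≤ (C + 2) * strictSeminorm ix f + (1 / 4) ^ n * ‖of.symm f‖ := by
      intro n
      have h1 := map_add_le_add (p i) (ofC0 (cut (χ n) f)) (f - ofC0 (cut (χ n) f))
      rw [add_sub_cancel] at h1
      have h2 := hK n i (f - ofC0 (cut (χ n) f)) fun x hx => (hχ n).sub_cut_eq_zero f hx
      have h3 := mul_le_mul_of_nonneg_left ((hχ n).norm_sub_cut_le f) (h4 n).le
      have h5 := hsum n i f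
      have h6 : 0 ≤ 2 * (1 / 2 : ℝ) ^ n * strictSeminorm ix f :=
        mul_nonneg (by positivity) (hq0 f)
      linarith
    have hl : Tendsto (fun n : ℕ => (C + 2) * strictSeminorm ix f
        + (1 / 4 : ℝ) ^ n * ‖of.symm f‖) atTop (𝓝 ((C + 2) * strictSeminorm ix f + 0 * _)) :=
      ((tendsto_pow_atTop_nhds_zero_of_lt_one (by norm_num) (by norm_num)).mul_const _).const_add _
    rw [zero_mul, add_zero] at hl
    exact ge_of_tendsto' hl hb

end Cutoff

end StrictCb

namespace StrictCb

/-! ### Integration of strictly continuous curves -/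

section Integral

variable {X : Type*} [TopologicalSpace X]

/-- The curve need not be norm continuous, but each strict seminorm is bounded on the compact
interval, and strictly bounded sets are norm bounded. -/
theorem exists_norm_le_of_continuous (F : C(ℝ, StrictCb X)) (a b : ℝ) :
    ∃ M : ℝ, 0 ≤ M ∧ ∀ s ∈ uIcc a b, ‖of.symm (F s)‖ ≤ M := by
  obtain ⟨M, hM, h⟩ := exists_norm_le_of_forall_seminorm (fun s : uIcc a b => F s) fun i => by
    obtain ⟨C, hC⟩ := (isCompact_uIcc (a := a) (b := b)).bddAbove_image
      ((continuous_strictSeminorm i).comp F.continuous).continuousOn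
    exact ⟨C, fun s => hC ⟨s, s.2, rfl⟩⟩
  exact ⟨M, hM, fun s hs => h ⟨s, hs⟩⟩

theorem continuous_apply (F : C(ℝ, StrictCb X)) (x : X) : Continuous fun s => F s x :=
  (evalL x).continuous.comp F.continuous

variable [LocallyCompactSpace X]

/-- Strict convergence is uniform on a compact neighbourhood of `x`. This is what makes the
pointwise integral a continuous function on `X`. -/
theorem continuous_uncurry (F : C(ℝ, StrictCb X)) :
    Continuous fun z : ℝ × X => F z.1 z.2 := by
  rw [continuous_iff_continuousAt]
  rintro ⟨s, x⟩
  obtain ⟨K, hK, hx⟩ := exists_compact_mem_nhds x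
  have h1 := tendsto_iff_seminorm.1 (F.continuous.tendsto s) _
    (continuous_strictSeminorm (compactIndex ⟨K, hK⟩))
  have h2 : Tendsto (fun y => |F s y - F s x|) (𝓝 x) (𝓝 0) := by
    simpa using (((F s).continuous_coe.tendsto x).sub_const (F s x)).abs
  have h3 := (h1.comp (tendsto_fst (f := 𝓝 s) (g := 𝓝 x))).add
    (h2.comp (tendsto_snd (f := 𝓝 s) (g := 𝓝 x)))
  rw [add_zero, ← nhds_prod_eq] at h3
  refine tendsto_iff_dist_tendsto_zero.2
    (squeeze_zero' (Eventually.of_forall fun _ => dist_nonneg) ?_ h3)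
  rw [nhds_prod_eq]
  filter_upwards [tendsto_snd.eventually hx] with z hz
  have h4 := abs_le_compactIndex ⟨K, hK⟩ (F z.1 - F s) hz
  rw [sub_apply] at h4
  rw [Real.dist_eq]
  exact (abs_sub_le _ (F s z.2) _).trans (add_le_add_left h4 _)

/-- The integral over `[a, b]` of a strictly continuous curve, computed pointwise. -/
noncomputable def integral (F : C(ℝ, StrictCb X)) (a b : ℝ) : StrictCb X :=
  of (BoundedContinuousFunction.ofNormedAddCommGroup (fun x => ∫ s in a..b, F s x)
    (intervalIntegral.continuous_parametric_intervalIntegral_of_continuous'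
      (f := fun x s => F s x) ((continuous_uncurry F).comp continuous_swap) a b)
    ((exists_norm_le_of_continuous F a b).choose * |b - a|)
    fun x => intervalIntegral.norm_integral_le_of_norm_le_const fun s hs =>
      (abs_apply_le (F s) x).trans
        ((exists_norm_le_of_continuous F a b).choose_spec.2 s (uIoc_subset_uIcc hs)))

@[simp] theorem integral_apply (F : C(ℝ, StrictCb X)) (a b : ℝ) (x : X) :
    integral F a b x = ∫ s in a..b, F s x := rfl

theorem integral_sub (F G : C(ℝ, StrictCb X)) (a b : ℝ) :
    integral (F - G) a b = integral F a b - integral G a b := by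
  ext x
  exact intervalIntegral.integral_sub ((continuous_apply F x).intervalIntegrable a b)
    ((continuous_apply G x).intervalIntegrable a b)

theorem integral_const (f : StrictCb X) (a b : ℝ) :
    integral (.const ℝ f) a b = (b - a) • f := by
  ext x
  simp

theorem strictSeminorm_integral_le (i : Index X) (F : C(ℝ, StrictCb X)) (a b : ℝ) {C : ℝ}
    (hC : 0 ≤ C) (h : ∀ s ∈ uIcc a b, strictSeminorm i (F s) ≤ C) :
    strictSeminorm i (integral F a b) ≤ C * |b - a| := by
  refine strictSeminorm_le (by positivity) fun n x hx => ?_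
  have hn : 0 ≤ ((i.2.1 n : ℝ≥0) : ℝ) := (i.2.1 n).2
  rw [integral_apply, ← abs_of_nonneg hn, ← abs_mul, ← intervalIntegral.integral_const_mul,
    ← Real.norm_eq_abs]
  refine intervalIntegral.norm_integral_le_of_norm_le_const fun s hs => ?_
  rw [Real.norm_eq_abs, abs_mul, abs_of_nonneg hn]
  exact (le_strictSeminorm i (F s) n hx).trans (h s (uIoc_subset_uIcc hs))

theorem norm_integral_le (F : C(ℝ, StrictCb X)) (a b : ℝ) {C : ℝ}
    (hC : 0 ≤ C) (h : ∀ s ∈ uIcc a b, ‖of.symm (F s)‖ ≤ C) :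
    ‖of.symm (integral F a b)‖ ≤ C * |b - a| :=
  norm_le (by positivity) fun x => by
    rw [integral_apply, ← Real.norm_eq_abs]
    exact intervalIntegral.norm_integral_le_of_norm_le_const fun s hs =>
      (abs_apply_le (F s) x).trans (h s (uIoc_subset_uIcc hs))

theorem tendsto_slope_integral (F : C(ℝ, StrictCb X)) (b : ℝ) :
    Tendsto (fun t => (t - b)⁻¹ • integral F b t) (𝓝[≠] b) (𝓝 (F b)) := by
  rw [withSeminorms_strict.tendsto_nhds]
  intro i ε hε
  have h1 := (tendsto_iff_seminorm.1 (F.continuous.tendsto b) _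
    (continuous_strictSeminorm i)).eventually (gt_mem_nhds (half_pos hε))
  obtain ⟨δ, hδ, h2⟩ := Metric.eventually_nhds_iff_ball.1 h1
  filter_upwards [self_mem_nhdsWithin, mem_nhdsWithin_of_mem_nhds (Metric.ball_mem_nhds b hδ)]
    with t ht htδ
  have ht0 : t - b ≠ 0 := sub_ne_zero.2 ht
  obtain ⟨G, hG, hG'⟩ : ∃ G : C(ℝ, StrictCb X), (∀ s, G s = F s - F b) ∧
      integral G b t = integral F b t - (t - b) • F b :=
    ⟨F - .const ℝ (F b), fun s => rfl, by rw [integral_sub, integral_const]⟩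
  have h3 : (t - b)⁻¹ • integral F b t - F b = (t - b)⁻¹ • integral G b t := by
    rw [hG', smul_sub, smul_smul, inv_mul_cancel₀ ht0, one_smul]
  have h5 : ∀ s ∈ uIcc b t, strictSeminorm i (G s) ≤ ε / 2 := fun s hs => by
    rw [hG]
    exact (h2 s ((convex_ball b δ).ordConnected.uIcc_subset
      (Metric.mem_ball_self hδ) htδ hs)).le
  have h4 := strictSeminorm_integral_le i G b t (half_pos hε).le h5
  have h6 : 0 < |t - b| := abs_pos.2 ht0
  have h7 : strictSeminorm i ((t - b)⁻¹ • integral F b t - F b) < ε := by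
    rw [h3, map_smul_eq_mul, norm_inv, Real.norm_eq_abs, inv_mul_lt_iff₀ h6]
    refine h4.trans_lt ?_
    rw [mul_comm]
    exact mul_lt_mul_of_pos_left (half_lt_self hε) h6
  exact h7

theorem integral_add_adjacent (F : C(ℝ, StrictCb X)) (a b c : ℝ) :
    integral F a b + integral F b c = integral F a c := by
  ext x
  exact intervalIntegral.integral_add_adjacent_intervals
    ((continuous_apply F x).intervalIntegrable a b) ((continuous_apply F x).intervalIntegrable b c)

/-- Strictly continuous functionals commute with the integral. -/
theorem map_integral (ℓ : StrictCb X →L[ℝ] ℝ) (F : C(ℝ, StrictCb X)) (a b : ℝ) :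
    ℓ (integral F a b) = ∫ s in a..b, ℓ (F s) := by
  -- Both sides are primitives of `ℓ ∘ F`, by the strict fundamental theorem of calculus; no
  -- description of the strict dual is needed.
  have h1 : ∀ s, HasDerivAt (fun t => ℓ (integral F a t)) (ℓ (F s)) s := fun s => by
    rw [hasDerivAt_iff_tendsto_slope]
    refine ((ℓ.continuous.tendsto _).comp (tendsto_slope_integral F s)).congr fun t => ?_
    simp only [Function.comp_apply, slope_def_module, map_smul, ← integral_add_adjacent F a s t,
      map_add, add_sub_cancel_left]
  have h2 := intervalIntegral.integral_eq_sub_of_hasDerivAt (a := a) (b := b) (fun s _ => h1 s)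
    ((ℓ.continuous.comp F.continuous).intervalIntegrable a b)
  rw [h2]
  have h3 : integral F a a = 0 := by ext x; simp
  rw [h3, map_zero, sub_zero]

end Integral

/-! ### Orbits of SCLE semigroups and closedness of the generator -/

section Orbit

variable {X : Type*} [TopologicalSpace X] {S : ℝ≥0 → StrictCb X →L[ℝ] StrictCb X}

/-- The orbit of `f`, extended to negative times by `f`. -/
noncomputable def orbit (hS : IsSCLE S) (f : StrictCb X) : C(ℝ, StrictCb X) :=
  ⟨fun s => S s.toNNReal f, (hS.stronglyContinuous.continuous_orbit f).comp continuous_real_toNNReal⟩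

theorem orbit_apply (hS : IsSCLE S) (f : StrictCb X) (s : ℝ) : orbit hS f s = S s.toNNReal f := rfl

theorem semigroup_apply (hS : IsSCLE S) (s t : ℝ≥0) (f : StrictCb X) :
    S t (S s f) = S (t + s) f := by
  rw [← hS.stronglyContinuous.map_add]; rfl

/-- By local equicontinuity the images of the unit ball under all `S s`, `s ≤ t`, form a strictly
bounded family, hence a norm-bounded one. -/
theorem exists_norm_semigroup_le (hS : IsSCLE S) (t : ℝ≥0) :
    ∃ M : ℝ, 0 ≤ M ∧ ∀ s ≤ t, ∀ f, ‖of.symm (S s f)‖ ≤ M * ‖of.symm f‖ := by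
  obtain ⟨M, hM, h⟩ := exists_norm_le_of_forall_seminorm
    (fun z : {z : ℝ≥0 × StrictCb X // z.1 ≤ t ∧ ‖of.symm z.2‖ ≤ 1} => S z.1.1 z.1.2) fun i => by
      obtain ⟨q, hq, hSq⟩ := hS.locallyEquicontinuous t _ (continuous_strictSeminorm i)
      obtain ⟨C, hC, hqC⟩ := exists_le_norm_of_continuous q hq
      exact ⟨C, fun z => (hSq _ z.2.1 _).trans ((hqC _).trans (mul_le_of_le_one_right hC z.2.2))⟩
  refine ⟨M, hM, fun s hs f => ?_⟩
  rcases eq_or_ne ‖of.symm f‖ 0 with h0 | h0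
  · have : f = 0 := by
      rw [norm_eq_zero] at h0
      exact of.symm.injective (by rw [h0, map_zero])
    simp [this]
  · have hpos : 0 < ‖of.symm f‖ := lt_of_le_of_ne (norm_nonneg _) h0.symm
    have h1 := h ⟨(s, ‖of.symm f‖⁻¹ • f), hs, by
      rw [map_smul, norm_smul, norm_inv, norm_norm, inv_mul_cancel₀ h0]⟩
    simp only [map_smul, norm_smul, norm_inv, norm_norm] at h1
    rwa [inv_mul_le_iff₀ hpos, mul_comm] at h1

variable [LocallyCompactSpace X]

/-- The operator `f ↦ ∫₀ᵗ S s f ds`, as a linear map. -/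
noncomputable def orbitIntegralLM (hS : IsSCLE S) (t : ℝ≥0) : StrictCb X →ₗ[ℝ] StrictCb X where
  toFun f := integral (orbit hS f) 0 t
  map_add' f g := by
    ext x
    simp only [integral_apply, orbit_apply, map_add]
    exact intervalIntegral.integral_add ((continuous_apply (orbit hS f) x).intervalIntegrable _ _)
      ((continuous_apply (orbit hS g) x).intervalIntegrable _ _)
  map_smul' c f := by
    ext x
    simp only [integral_apply, orbit_apply, map_smul, RingHom.id_apply]
    exact intervalIntegral.integral_const_mul _ _

/-- The operator `f ↦ ∫₀ᵗ S s f ds`. -/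
noncomputable def orbitIntegral (hS : IsSCLE S) (t : ℝ≥0) : StrictCb X →L[ℝ] StrictCb X where
  toLinearMap := orbitIntegralLM hS t
  cont := by
    refine withSeminorms_strict.continuous_of_continuous_comp _ fun i => ?_
    obtain ⟨q, hq, hSq⟩ := hS.locallyEquicontinuous t _ (continuous_strictSeminorm i)
    refine Seminorm.continuous_of_le (q := t • q) ?_ fun f => ?_
    · have : Continuous fun f : StrictCb X => (t : ℝ) * q f := hq.const_mul _
      exact this
    · have h1 := strictSeminorm_integral_le i (orbit hS f) 0 t (apply_nonneg q f) fun s hs => by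
        rw [uIcc_of_le t.coe_nonneg] at hs
        exact hSq _ (Real.toNNReal_le_iff_le_coe.2 hs.2) f
      rw [sub_zero, abs_of_nonneg t.coe_nonneg, mul_comm] at h1
      exact h1

theorem orbitIntegral_eq (hS : IsSCLE S) (t : ℝ≥0) (f : StrictCb X) :
    orbitIntegral hS t f = integral (orbit hS f) 0 t := rfl

/-- Evaluation at `x` after `S h` is a strictly continuous functional, so it passes under the
integral; the rest is a translation of the variable. -/
theorem semigroup_orbitIntegral (hS : IsSCLE S) (h t : ℝ≥0) (f : StrictCb X) :
    S h (orbitIntegral hS t f) = integral (orbit hS f) h (t + h) := by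
  ext x
  have h1 := map_integral ((evalL x).comp (S h)) (orbit hS f) 0 t
  simp only [ContinuousLinearMap.comp_apply, evalL_apply] at h1
  rw [orbitIntegral_eq, h1, integral_apply]
  have h2 := intervalIntegral.integral_comp_add_right (a := 0) (b := (t : ℝ))
    (fun s => orbit hS f s x) (h : ℝ)
  rw [zero_add] at h2
  rw [← h2]
  refine intervalIntegral.integral_congr fun s hs => ?_
  rw [uIcc_of_le t.coe_nonneg] at hs
  simp only [orbit_apply]
  rw [semigroup_apply hS, Real.toNNReal_add hs.1 h.coe_nonneg, Real.toNNReal_coe, add_comm]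

theorem tendsto_inv_smul_orbitIntegral (hS : IsSCLE S) (f : StrictCb X) :
    Tendsto (fun t : ℝ≥0 => (t : ℝ)⁻¹ • orbitIntegral hS t f) (𝓝[>] 0) (𝓝 f) := by
  have h1 := tendsto_slope_integral (orbit hS f) 0
  have h2 : Tendsto (fun t : ℝ≥0 => (t : ℝ)) (𝓝[>] 0) (𝓝[≠] (0 : ℝ)) := by
    refine tendsto_nhdsWithin_iff.2 ⟨?_, ?_⟩
    · exact (NNReal.continuous_coe.tendsto 0).mono_left nhdsWithin_le_nhds
    · filter_upwards [self_mem_nhdsWithin] with t ht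
      exact (NNReal.coe_pos.2 ht).ne'
  have h3 := h1.comp h2
  simpa [Function.comp_def, orbit_apply, hS.stronglyContinuous.map_zero, orbitIntegral_eq] using h3

/-- The integrated form replaces a limit by equations between continuous operators, from which
closedness of the graph is immediate. -/
theorem mem_generator_iff (hS : IsSCLE S) (z : StrictCb X × StrictCb X) :
    z ∈ generator S ↔ ∀ t : ℝ≥0, S t z.1 - z.1 = orbitIntegral hS t z.2 := by
  constructor
  · intro hz t
    ext x
    -- The semigroup law, with `S r - S s = S s (S (r - s) - 1)` for `r > s`, gives right
    -- derivatives only, which suffices for the fundamental theorem of calculus.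
    have hd : ∀ s ∈ Ioo (min (0 : ℝ) t) (max (0 : ℝ) t),
        HasDerivWithinAt (fun s => orbit hS z.1 s x) (orbit hS z.2 s x) (Ioi s) s := by
      intro s hs
      rw [min_eq_left t.coe_nonneg, max_eq_right t.coe_nonneg] at hs
      rw [hasDerivWithinAt_iff_tendsto_slope' self_notMem_Ioi]
      have h1 : Tendsto (fun r : ℝ => (r - s).toNNReal) (𝓝[>] s) (𝓝[>] 0) := by
        refine tendsto_nhdsWithin_iff.2 ⟨?_, ?_⟩
        · have : Continuous fun r : ℝ => (r - s).toNNReal := by fun_prop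
          simpa using (this.tendsto s).mono_left nhdsWithin_le_nhds
        · filter_upwards [self_mem_nhdsWithin] with r hr
          exact Real.toNNReal_pos.2 (sub_pos.2 hr)
      have h2 := ((((evalL x).comp (S s.toNNReal)).continuous.tendsto _).comp hz).comp h1
      refine h2.congr' ?_
      filter_upwards [self_mem_nhdsWithin] with r hr
      have hr' : s < r := hr
      simp only [Function.comp_apply, ContinuousLinearMap.comp_apply, map_smul, map_sub,
        semigroup_apply hS, evalL_apply, slope_def_module, orbit_apply]
      rw [← Real.toNNReal_add hs.1.le (sub_pos.2 hr').le, Real.coe_toNNReal _ (sub_pos.2 hr').le,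
        add_sub_cancel]
    have h := intervalIntegral.integral_eq_sub_of_hasDeriv_right (a := (0 : ℝ)) (b := t)
      (continuous_apply (orbit hS z.1) x).continuousOn hd
      ((continuous_apply (orbit hS z.2) x).intervalIntegrable _ _)
    rw [orbitIntegral_eq, integral_apply, h]
    simp [orbit_apply, hS.stronglyContinuous.map_zero]
  · intro h
    have := tendsto_inv_smul_orbitIntegral hS z.2
    simp only [← h] at this
    exact this

theorem isClosed_generator (hS : IsSCLE S) : IsClosed (generator S) := by
  have : generator S = {z | ∀ t : ℝ≥0, S t z.1 - z.1 = orbitIntegral hS t z.2} :=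
    Set.ext fun z => mem_generator_iff hS z
  rw [this, Set.ofPred_forall]
  exact isClosed_iInter fun t => isClosed_eq
    (((S t).continuous.comp continuous_fst).sub continuous_fst)
    ((orbitIntegral hS t).continuous.comp continuous_snd)

end Orbit

end StrictCb

/-- Needed for dominated convergence as `x → ∞`, which requires a countably generated filter. -/
theorem isCountablyGenerated_cocompact (X : Type*) [TopologicalSpace X] [WeaklyLocallyCompactSpace X]
    [SigmaCompactSpace X] [T2Space X] : (cocompact X).IsCountablyGenerated := by
  let K : CompactExhaustion X := default
  have h : (cocompact X).HasBasis (fun _ : ℕ => True) fun n => (K n)ᶜ := by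
    refine ⟨fun s => ?_⟩
    rw [mem_cocompact]
    constructor
    · rintro ⟨t, ht, hts⟩
      obtain ⟨n, hn⟩ := K.exists_superset_of_isCompact ht
      exact ⟨n, trivial, (compl_subset_compl.2 hn).trans hts⟩
    · rintro ⟨n, -, hn⟩
      exact ⟨K n, K.isCompact n, hn⟩
  exact HasCountableBasis.isCountablyGenerated ⟨h, to_countable _⟩

/-! ### Tightness of functionals on `C_0(X)` -/

namespace ZeroAtInftyContinuousMap

variable {X : Type*} [TopologicalSpace X]

theorem abs_apply_le_norm (f : C₀(X, ℝ)) (x : X) : |f x| ≤ ‖f‖ := f.toBCF.norm_coe_le_norm x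

theorem norm_le_of_forall {f : C₀(X, ℝ)} {C : ℝ} (hC : 0 ≤ C) (h : ∀ x, |f x| ≤ C) : ‖f‖ ≤ C :=
  (BoundedContinuousFunction.norm_le (f := f.toBCF) hC).2 h

/-- Functionals on `C_0(X)` are tight. -/
theorem exists_isCompact_abs_le (φ : StrongDual ℝ C₀(X, ℝ)) {ε : ℝ} (hε : 0 < ε) :
    ∃ K : Set X, IsCompact K ∧ ∀ g : C₀(X, ℝ), (∀ x ∈ K, g x = 0) → φ g ≤ ε * ‖g‖ := by
  obtain ⟨δ, hδ, hδε⟩ : ∃ δ > 0, ‖φ‖ * δ ≤ ε / 2 := by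
    refine ⟨ε / 2 / (‖φ‖ + 1), by positivity, ?_⟩
    rw [mul_div_assoc', div_le_iff₀ (by positivity)]
    nlinarith [norm_nonneg φ]
  -- Since `g₀` almost attains the norm of `φ` and is below `δ` off `K`, adding a `g` of norm at
  -- most `1` that vanishes on `K` raises the norm to at most `1 + δ`, leaving little room for `φ
  -- g`.
  obtain ⟨g₀, hg₀, hφ⟩ : ∃ g₀ : C₀(X, ℝ), ‖g₀‖ ≤ 1 ∧ ‖φ‖ - ε / 2 ≤ φ g₀ := by
    by_contra! h
    have h0 : 0 ≤ ‖φ‖ - ε / 2 := by simpa using (h 0 (by simp)).le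
    have : ‖φ‖ ≤ ‖φ‖ - ε / 2 := by
      refine φ.opNorm_le_of_unit_norm h0 fun g hg => abs_le.2 ⟨?_, (h g hg.le).le⟩
      have := h (-g) (by rw [norm_neg, hg])
      rw [map_neg] at this
      linarith
    linarith
  obtain ⟨K, hK, hKδ⟩ := mem_cocompact.1
    (g₀.zero_at_infty'.eventually (Metric.ball_mem_nhds 0 hδ))
  refine ⟨K, hK, fun g hg => ?_⟩
  have key : ∀ g : C₀(X, ℝ), (∀ x ∈ K, g x = 0) → ‖g‖ ≤ 1 → φ g ≤ ε := fun g hg hg1 => by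
    have h1 : ‖g₀ + g‖ ≤ 1 + δ := norm_le_of_forall (by positivity) fun x => by
      rw [add_apply]
      by_cases hx : x ∈ K
      · rw [hg x hx, add_zero]
        linarith [abs_apply_le_norm g₀ x]
      · have h2 : |g₀ x| < δ := by simpa using hKδ hx
        have h3 := abs_apply_le_norm g x
        have h4 := abs_add_le (g₀ x) (g x)
        linarith
    have h2 := (le_abs_self _).trans (φ.le_opNorm_of_le h1)
    rw [map_add] at h2
    linarith
  rcases eq_or_ne g 0 with rfl | h0
  · simp
  · have hpos : 0 < ‖g‖ := norm_pos_iff.2 h0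
    have h1 := key (‖g‖⁻¹ • g) (fun x hx => by simp [hg x hx])
      (by rw [norm_smul, norm_inv, norm_norm, inv_mul_cancel₀ hpos.ne'])
    rw [map_smul, smul_eq_mul, inv_mul_le_iff₀ hpos] at h1
    linarith

open StrictCb in
/-- On bounded sets, functionals on `C_0(X)` are continuous for the strict topology. -/
theorem tendsto_of_tendsto_strict [T2Space X] [LocallyCompactSpace X] (φ : StrongDual ℝ C₀(X, ℝ))
    {α : Type*} {l : Filter α} {u : α → C₀(X, ℝ)} {f : C₀(X, ℝ)} {M : ℝ} (hM : 0 ≤ M)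
    (hu : ∀ᶠ a in l, ‖u a‖ ≤ M) (h : Tendsto (fun a => ofC0 (u a)) l (𝓝 (ofC0 f))) :
    Tendsto (fun a => φ (u a)) l (𝓝 (φ f)) := by
  rw [Metric.tendsto_nhds]
  intro ε hε
  have hpos : 0 < ε / 2 / (M + ‖f‖ + 1) := by positivity
  obtain ⟨K, hK, hφ⟩ := exists_isCompact_abs_le φ hpos
  obtain ⟨χ, hχ, L, hL⟩ := exists_isCutoff hK
  have h1 := (tendsto_iff_seminorm.1 h _ (continuous_strictSeminorm (compactIndex L))).eventually
    (gt_mem_nhds (show 0 < ε / 2 / (‖φ‖ + 1) by positivity))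
  filter_upwards [hu, h1] with a ha h2
  obtain ⟨v, hv⟩ : ∃ v, v = u a - f := ⟨_, rfl⟩
  have hva : ofC0 (u a) - ofC0 f = ofC0 v := by rw [hv, map_sub]
  rw [hva] at h2
  rw [dist_eq_norm, ← map_sub, ← hv]
  have hvM : ‖v‖ ≤ M + ‖f‖ := hv ▸ (norm_sub_le _ _).trans (add_le_add_left ha _)
  -- Splitting `v = w + (v - w)`: strict convergence makes `w` small in norm, as its support lies in
  -- `L`; tightness handles `v - w`, which vanishes on `K`.
  obtain ⟨w, hw⟩ : ∃ w, w = cut χ (ofC0 v) := ⟨_, rfl⟩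
  have hwL : ‖w‖ ≤ ε / 2 / (‖φ‖ + 1) := norm_le_of_forall (by positivity) fun x => by
    by_cases hx : x ∈ L
    · have h3 := abs_le_compactIndex L (ofC0 v) hx
      rw [hw, cut_apply, abs_mul, abs_of_nonneg (hχ.nonneg x)]
      exact (mul_le_of_le_one_left (abs_nonneg _) (hχ.le_one x)).trans (h3.trans h2.le)
    · rw [hw, cut_apply, hL x hx, zero_mul, abs_zero]
      positivity
  have hφw : |φ w| ≤ ε / 2 / (‖φ‖ + 1) * ‖φ‖ := by
    rw [mul_comm]
    exact φ.le_opNorm_of_le hwL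
  have h4 : ε / 2 / (‖φ‖ + 1) * ‖φ‖ ≤ ε / 2 := by
    rw [div_mul_eq_mul_div, div_le_iff₀ (by positivity)]
    nlinarith [norm_nonneg φ]
  have hnorm : ‖v - w‖ ≤ M + ‖f‖ := by
    have h5 := hχ.norm_sub_cut_le (ofC0 v)
    rw [← hw, ← map_sub, norm_ofC0, norm_ofC0] at h5
    exact h5.trans hvM
  have hzero : ∀ x ∈ K, (v - w) x = 0 := fun x hx => by
    simp [hw, hχ.eq_one x hx]
  have h6 := hφ (v - w) hzero
  have h7 := hφ (-(v - w)) fun x hx => by rw [neg_apply, hzero x hx, neg_zero]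
  rw [norm_neg, map_neg] at h7
  have h8 : ε / 2 / (M + ‖f‖ + 1) * ‖v - w‖ < ε / 2 := by
    refine (mul_le_mul_of_nonneg_left hnorm hpos.le).trans_lt ?_
    rw [div_mul_eq_mul_div, div_lt_iff₀ (by positivity)]
    nlinarith [norm_nonneg f]
  have h9 : φ v = φ w + φ (v - w) := by rw [← map_add, add_sub_cancel]
  rw [h9, Real.norm_eq_abs]
  have h10 := abs_le.1 hφw
  exact abs_lt.2 ⟨by linarith, by linarith⟩

end ZeroAtInftyContinuousMap

/-- A locally bounded semigroup that is continuous at `0` on every vector is strongly continuous. -/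
theorem continuous_orbit_of_tendsto_zero {E : Type*} [NormedAddCommGroup E] [NormedSpace ℝ E]
    {T : ℝ≥0 → E →L[ℝ] E} (hadd : ∀ s t : ℝ≥0, (T t).comp (T s) = T (t + s))
    (hbdd : ∀ t : ℝ≥0, ∃ M : ℝ, 0 ≤ M ∧ ∀ s ≤ t, ∀ f, ‖T s f‖ ≤ M * ‖f‖)
    (hzero : ∀ f, Tendsto (fun t => T t f) (𝓝 0) (𝓝 f)) (f : E) : Continuous fun t => T t f := by
  rw [continuous_iff_continuousAt]
  intro t
  obtain ⟨M, hM, hb⟩ := hbdd (t + 1)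
  -- With truncated subtraction `(s - t) + (t - s)` is `|s - t|`.
  have h1 : Tendsto (fun s : ℝ≥0 => (s - t) + (t - s)) (𝓝 t) (𝓝 0) := by
    have : Continuous fun s : ℝ≥0 => (s - t) + (t - s) := by fun_prop
    simpa using this.tendsto t
  have h2 : Tendsto (fun s : ℝ≥0 => M * ‖T ((s - t) + (t - s)) f - f‖) (𝓝 t) (𝓝 0) := by
    simpa using (((hzero f).comp h1).sub_const f).norm.const_mul M
  refine tendsto_iff_norm_sub_tendsto_zero.2
    (squeeze_zero' (Eventually.of_forall fun _ => norm_nonneg _) ?_ h2)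
  have hmap : ∀ a b, T a (T b f) = T (a + b) f := fun a b => by rw [← hadd]; rfl
  filter_upwards [gt_mem_nhds (show t < t + 1 by simp)] with s hs
  rcases le_total t s with hts | hts
  · rw [tsub_eq_zero_of_le hts, add_zero]
    have h3 : T s f - T t f = T t (T (s - t) f - f) := by
      rw [map_sub, hmap, add_tsub_cancel_of_le hts]
    rw [h3]
    exact hb t (by simp) _
  · rw [tsub_eq_zero_of_le hts, zero_add]
    have h3 : T s f - T t f = -T s (T (t - s) f - f) := by
      rw [map_sub, hmap, add_tsub_cancel_of_le hts, neg_sub]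
    rw [h3, norm_neg]
    exact hb s hs.le _

/-! ### Restriction to `C_0(X)` -/

namespace StrictCb

variable {X : Type*} [TopologicalSpace X] {S : ℝ≥0 → StrictCb X →L[ℝ] StrictCb X}

theorem exists_restriction (hS : IsSCLE S)
    (hmaps : ∀ t : ℝ≥0, MapsTo (S t) (range ofC0) (range ofC0)) :
    ∃ T : ℝ≥0 → C₀(X, ℝ) →L[ℝ] C₀(X, ℝ), Extends S T := by
  choose R hR using fun (t : ℝ≥0) (f : C₀(X, ℝ)) => hmaps t (mem_range_self f)
  choose M _ hM using fun t : ℝ≥0 => exists_norm_semigroup_le hS t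
  refine ⟨fun t => LinearMap.mkContinuous ⟨⟨R t, fun f g => ?_⟩, fun c f => ?_⟩ (M t) fun f => ?_,
    fun t f => (hR t f).symm⟩
  · exact ofC0_injective (by simp only [hR, map_add])
  · refine ofC0_injective ?_
    change ofC0 (R t (c • f)) = ofC0 (c • R t f)
    simp only [hR, map_smul]
  · have h := hM t t le_rfl (ofC0 f)
    rw [← hR, norm_ofC0, norm_ofC0] at h
    exact h

variable [LocallyCompactSpace X] [SigmaCompactSpace X] [T2Space X]

/-- Each integrand `S s f` vanishes at infinity and all are dominated by one constant, so dominated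
convergence applies. Norm measurability of the orbit, not yet available, is avoided. -/
theorem orbitIntegral_mem_range_ofC0 (hS : IsSCLE S) {T : ℝ≥0 → C₀(X, ℝ) →L[ℝ] C₀(X, ℝ)}
    (hT : Extends S T) (t : ℝ≥0) (f : C₀(X, ℝ)) :
    orbitIntegral hS t (ofC0 f) ∈ range (ofC0 : C₀(X, ℝ) →ₗ[ℝ] StrictCb X) := by
  have := isCountablyGenerated_cocompact X
  obtain ⟨M, hM, hb⟩ := exists_norm_le_of_continuous (orbit hS (ofC0 f)) 0 t
  have h : Tendsto (fun x => ∫ s in (0 : ℝ)..t, orbit hS (ofC0 f) s x) (cocompact X)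
      (𝓝 (∫ _ in (0 : ℝ)..t, (0 : ℝ))) := by
    refine intervalIntegral.tendsto_integral_filter_of_dominated_convergence (fun _ => M) ?_ ?_
      intervalIntegrable_const ?_
    · exact Eventually.of_forall fun x => (continuous_apply _ x).aestronglyMeasurable
    · exact Eventually.of_forall fun x => ae_of_all _ fun s hs =>
        (abs_apply_le _ x).trans (hb s (uIoc_subset_uIcc hs))
    · refine ae_of_all _ fun s _ => ?_
      rw [orbit_apply, hT]
      exact (T s.toNNReal f).zero_at_infty'
  rw [intervalIntegral.integral_zero] at h
  exact ⟨⟨⟨_, (orbitIntegral hS t (ofC0 f)).continuous_coe⟩, h⟩, rfl⟩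

theorem isStronglyContinuousSemigroup_of_extends (hS : IsSCLE S)
    {T : ℝ≥0 → C₀(X, ℝ) →L[ℝ] C₀(X, ℝ)} (hT : Extends S T) : IsStronglyContinuousSemigroup T := by
  have hadd : ∀ s t : ℝ≥0, (T t).comp (T s) = T (t + s) := fun s t => by
    ext1 f
    refine ofC0_injective ?_
    rw [ContinuousLinearMap.comp_apply, ← hT, ← hT, ← hT, semigroup_apply hS]
  have hbdd : ∀ t : ℝ≥0, ∃ M : ℝ, 0 ≤ M ∧ ∀ s ≤ t, ∀ f, ‖T s f‖ ≤ M * ‖f‖ := fun t => by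
    obtain ⟨M, hM, h⟩ := exists_norm_semigroup_le hS t
    refine ⟨M, hM, fun s hs f => ?_⟩
    have h1 := h s hs (ofC0 f)
    rwa [hT, norm_ofC0, norm_ofC0] at h1
  refine ⟨?_, hadd, continuous_orbit_of_tendsto_zero hadd hbdd ?_⟩
  · ext1 f
    refine ofC0_injective ?_
    rw [← hT, hS.stronglyContinuous.map_zero]; rfl
  let D : Submodule ℝ C₀(X, ℝ) :=
    { carrier := {f | Tendsto (fun t => T t f) (𝓝 0) (𝓝 f)}
      add_mem' := fun {f g} hf hg => by simpa using Tendsto.add hf hg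
      zero_mem' := by simp
      smul_mem' := fun c f hf => by simpa using Tendsto.const_smul hf c }
  have hD : ∀ f, f ∈ D ↔ Tendsto (fun t => T t f) (𝓝 0) (𝓝 f) := fun f => Iff.rfl
  obtain ⟨M, hM, hb⟩ := hbdd 1
  have hle1 : ∀ᶠ t : ℝ≥0 in 𝓝 0, t ≤ 1 := ge_mem_nhds zero_lt_one
  have hclosed : IsClosed (D : Set C₀(X, ℝ)) := by
    refine isClosed_of_closure_subset fun f hf => ?_
    rw [SetLike.mem_coe, hD, Metric.tendsto_nhds]
    intro ε hε
    obtain ⟨g, hg, hfg⟩ := Metric.mem_closure_iff.1 hf (ε / 2 / (M + 1)) (by positivity)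
    rw [lt_div_iff₀ (by positivity), dist_eq_norm] at hfg
    filter_upwards [hle1, Metric.tendsto_nhds.1 ((hD g).1 hg) (ε / 2) (half_pos hε)] with t ht h1
    rw [dist_eq_norm] at h1 ⊢
    have h2 : T t f - f = T t (f - g) + (T t g - g) - (f - g) := by rw [map_sub]; abel
    rw [h2]
    have h3 := norm_sub_le (T t (f - g) + (T t g - g)) (f - g)
    have h4 := norm_add_le (T t (f - g)) (T t g - g)
    have h5 := hb t ht (f - g)
    linarith
  choose J hJ using orbitIntegral_mem_range_ofC0 hS hT
  -- Applying `T r` shifts the interval of integration, so the change is a difference of two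
  -- integrals over intervals of length `r`, of norm at most `2 * N * r`.
  have hJD : ∀ t f, J t f ∈ D := fun t f => by
    rw [hD]
    obtain ⟨N, hN, hNb⟩ := exists_norm_le_of_continuous (orbit hS (ofC0 f)) 0 (t + 1)
    have hint : ∀ a b : ℝ, 0 ≤ a → a ≤ b → b ≤ t + 1 →
        ‖of.symm (integral (orbit hS (ofC0 f)) a b)‖ ≤ N * |b - a| := fun a b ha hab hb =>
      norm_integral_le _ _ _ hN fun s hs => hNb s <| by
        rw [uIcc_of_le hab] at hs
        rw [uIcc_of_le (by linarith)]
        exact ⟨ha.trans hs.1, hs.2.trans hb⟩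
    have hz : Tendsto (fun r : ℝ≥0 => 2 * N * (r : ℝ)) (𝓝 0) (𝓝 0) := by
      have : Continuous fun r : ℝ≥0 => 2 * N * (r : ℝ) := by fun_prop
      simpa using this.tendsto 0
    refine tendsto_iff_norm_sub_tendsto_zero.2
      (squeeze_zero' (Eventually.of_forall fun _ => norm_nonneg _) ?_ hz)
    filter_upwards [hle1] with r hr
    have hr' : (r : ℝ) ≤ 1 := hr
    rw [← norm_ofC0, map_sub, ← hT, hJ, semigroup_orbitIntegral, orbitIntegral_eq]
    have e1 := integral_add_adjacent (orbit hS (ofC0 f)) 0 r (t + r)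
    have e2 := integral_add_adjacent (orbit hS (ofC0 f)) 0 t (t + r)
    have e3 : integral (orbit hS (ofC0 f)) r (t + r) - integral (orbit hS (ofC0 f)) 0 t
        = integral (orbit hS (ofC0 f)) t (t + r) - integral (orbit hS (ofC0 f)) 0 r := by
      rw [sub_eq_sub_iff_add_eq_add]
      exact (add_comm _ _).trans (e1.trans (e2.symm.trans (add_comm _ _)))
    rw [e3, map_sub]
    refine (norm_sub_le _ _).trans ?_
    have h1 := hint t (t + r) t.coe_nonneg (by simp) (by linarith)
    have h2 := hint 0 r le_rfl r.coe_nonneg (by linarith [t.coe_nonneg])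
    rw [add_sub_cancel_left, abs_of_nonneg r.coe_nonneg] at h1
    rw [sub_zero, abs_of_nonneg r.coe_nonneg] at h2
    linarith
  intro f
  rw [← hD]
  by_contra hf
  obtain ⟨φ, u, hφD, hφf⟩ := geometric_hahn_banach_closed_point D.convex hclosed hf
  -- The averages lie in `D`, stay norm bounded and converge strictly to `f`; so `φ` cannot separate
  -- `f` from `D`.
  have hlim : Tendsto (fun t : ℝ≥0 => φ ((t : ℝ)⁻¹ • J t f)) (𝓝[>] 0) (𝓝 (φ f)) := by
    refine ZeroAtInftyContinuousMap.tendsto_of_tendsto_strict φ (M := M * ‖f‖) (by positivity) ?_ ?_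
    · filter_upwards [mem_nhdsWithin_of_mem_nhds hle1, self_mem_nhdsWithin] with t ht ht0
      have ht0' : 0 < (t : ℝ) := ht0
      rw [norm_smul, norm_inv, Real.norm_eq_abs, abs_of_pos ht0', inv_mul_le_iff₀ ht0', ← norm_ofC0,
        hJ, orbitIntegral_eq, mul_comm]
      have h1 := norm_integral_le (orbit hS (ofC0 f)) 0 t (C := M * ‖f‖) (by positivity)
        fun s hs => by
          rw [uIcc_of_le t.coe_nonneg] at hs
          rw [orbit_apply, hT, norm_ofC0]
          exact hb _ ((Real.toNNReal_le_iff_le_coe.2 hs.2).trans ht) f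
      rwa [sub_zero, abs_of_pos ht0'] at h1
    · simp only [map_smul, hJ]
      exact tendsto_inv_smul_orbitIntegral hS (ofC0 f)
  have := le_of_tendsto' hlim fun t => (hφD _ (D.smul_mem _ (hJD t f))).le
  linarith

end StrictCb

namespace StrictCb

/-! ### Operators given by vaguely continuous probability kernels -/

section Probability

variable {X : Type*} [TopologicalSpace X] [MeasurableSpace X]

theorem integrable_prob [BorelSpace X] (μ : ProbabilityMeasure X) (f : StrictCb X) :
    Integrable f (μ : Measure X) :=
  (of.symm f : X →ᵇ ℝ).integrable _

theorem abs_integral_prob_le (μ : ProbabilityMeasure X) (f : StrictCb X) :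
    |∫ x, f x ∂(μ : Measure X)| ≤ ‖of.symm f‖ := by
  have h := norm_integral_le_of_norm_le_const (μ := (μ : Measure X)) (f := f)
    (ae_of_all _ (abs_apply_le f))
  simpa using h

variable [BorelSpace X] [PolishSpace X] [LocallyCompactSpace X] {Z : Type*} [TopologicalSpace Z]

/-- Vaguely continuous families of probability measures are locally uniformly tight. -/
theorem eventually_abs_integral_le {P : Z → ProbabilityMeasure X}
    (hP : ∀ χ : C₀(X, ℝ), Continuous fun z => ∫ x, χ x ∂(P z : Measure X)) (z₀ : Z) {ε : ℝ}
    (hε : 0 < ε) : ∃ L : TopologicalSpace.Compacts X, ∀ᶠ z in 𝓝 z₀, ∀ f : StrictCb X,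
      (∀ x ∈ L, f x = 0) → |∫ x, f x ∂(P z : Measure X)| ≤ ε * ‖of.symm f‖ := by
  obtain ⟨K, -, hK, hμK⟩ := MeasurableSet.univ.exists_isCompact_lt_add
    (measure_ne_top (P z₀ : Measure X) univ) (ENNReal.ofReal_pos.2 hε).ne'
  obtain ⟨χ, hχ, L, hL⟩ := exists_isCutoff hK
  have hint : ∀ z, Integrable χ (P z : Measure X) := fun z => integrable_prob (P z) (ofC0 χ)
  have h1 : 1 - ε < ∫ x, χ x ∂(P z₀ : Measure X) := by
    have h2 : (P z₀ : Measure X).real K ≤ ∫ x, χ x ∂(P z₀ : Measure X) := by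
      have h3 : ∫ x in K, χ x ∂(P z₀ : Measure X) = (P z₀ : Measure X).real K := by
        rw [setIntegral_congr_fun hK.measurableSet (g := fun _ => (1 : ℝ)) fun x hx =>
          hχ.eq_one x hx]
        simp
      rw [← h3]
      exact setIntegral_le_integral (hint z₀) (ae_of_all _ hχ.nonneg)
    have h4 := ENNReal.toReal_strict_mono (by finiteness) hμK
    rw [measure_univ, ENNReal.toReal_add (by finiteness) (by finiteness), ENNReal.toReal_ofReal hε.le,
      ENNReal.toReal_one] at h4
    have h5 : ((P z₀ : Measure X) K).toReal = (P z₀ : Measure X).real K := rfl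
    linarith
  refine ⟨L, ?_⟩
  filter_upwards [((hP χ).tendsto z₀).eventually (lt_mem_nhds h1)] with z hz f hf
  -- As the total mass is one, `1 - χ` has integral below `ε` for all `z` near `z₀`: continuity
  -- against the single test function `χ` gives uniform tightness.
  have h2 : ∀ x, ‖f x‖ ≤ ‖of.symm f‖ * (1 - χ x) := fun x => by
    by_cases hx : x ∈ L
    · rw [hf x hx, norm_zero]
      exact mul_nonneg (norm_nonneg _) (sub_nonneg.2 (hχ.le_one x))
    · rw [hL x hx, sub_zero, mul_one]
      exact abs_apply_le f x
  have h3 := norm_integral_le_of_norm_le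
    (((integrable_const (1 : ℝ)).sub (hint z)).const_mul ‖of.symm f‖) (ae_of_all _ h2)
  simp only [Pi.sub_apply] at h3
  rw [integral_const_mul, MeasureTheory.integral_sub (integrable_const _) (hint z)] at h3
  simp only [MeasureTheory.integral_const, probReal_univ, smul_eq_mul, mul_one] at h3
  refine h3.trans ?_
  rw [mul_comm]
  exact mul_le_mul_of_nonneg_right (by linarith) (norm_nonneg _)

theorem exists_compacts_abs_integral_le {P : Z → ProbabilityMeasure X}
    (hP : ∀ χ : C₀(X, ℝ), Continuous fun z => ∫ x, χ x ∂(P z : Measure X)) {A : Set Z}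
    (hA : IsCompact A) {ε : ℝ} (hε : 0 < ε) :
    ∃ L : TopologicalSpace.Compacts X, ∀ z ∈ A, ∀ f : StrictCb X,
      (∀ x ∈ L, f x = 0) → |∫ x, f x ∂(P z : Measure X)| ≤ ε * ‖of.symm f‖ := by
  refine hA.induction_on (p := fun A => ∃ L : TopologicalSpace.Compacts X, ∀ z ∈ A,
    ∀ f : StrictCb X, (∀ x ∈ L, f x = 0) →
      |∫ x, f x ∂(P z : Measure X)| ≤ ε * ‖of.symm f‖) ⟨⊥, by simp⟩ ?_ ?_ ?_
  · rintro s t hst ⟨L, hL⟩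
    exact ⟨L, fun z hz => hL z (hst hz)⟩
  · rintro s t ⟨L, hL⟩ ⟨L', hL'⟩
    refine ⟨L ⊔ L', fun z hz f hf => ?_⟩
    rcases hz with hz | hz
    · exact hL z hz f fun x hx => hf x (Or.inl hx)
    · exact hL' z hz f fun x hx => hf x (Or.inr hx)
  · intro z _
    obtain ⟨L, hL⟩ := eventually_abs_integral_le hP z hε
    exact ⟨_, mem_nhdsWithin_of_mem_nhds hL, L, fun _ h => h⟩

/-- Vaguely continuous families of probability measures are weakly continuous. -/
theorem continuous_integral_prob {P : Z → ProbabilityMeasure X}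
    (hP : ∀ χ : C₀(X, ℝ), Continuous fun z => ∫ x, χ x ∂(P z : Measure X)) (f : StrictCb X) :
    Continuous fun z => ∫ x, f x ∂(P z : Measure X) := by
  rw [continuous_iff_continuousAt]
  -- Local tightness makes the integral of `f` a locally uniform limit of integrals of `cut χ f`,
  -- which are continuous by hypothesis.
  refine fun z₀ => continuousAt_of_locally_uniform_approx_of_continuousAt fun u hu => ?_
  obtain ⟨ε, hε, hεu⟩ := Metric.mem_uniformity_dist.1 hu
  obtain ⟨L, hL⟩ := eventually_abs_integral_le hP z₀
    (show 0 < ε / (‖of.symm f‖ + 1) by positivity)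
  obtain ⟨χ, hχ, -⟩ := exists_isCutoff L.isCompact
  refine ⟨_, hL, fun z => ∫ x, cut χ f x ∂(P z : Measure X), (hP _).continuousAt,
    fun z hz => hεu ?_⟩
  have h1 := hz (f - ofC0 (cut χ f)) fun x hx => hχ.sub_cut_eq_zero f hx
  have h2 : ∫ x, (f - ofC0 (cut χ f)) x ∂(P z : Measure X)
      = ∫ x, f x ∂(P z : Measure X) - ∫ x, cut χ f x ∂(P z : Measure X) :=
    MeasureTheory.integral_sub (integrable_prob _ f) (integrable_prob _ (ofC0 (cut χ f)))
  rw [Real.dist_eq, ← h2]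
  refine h1.trans_lt ((mul_le_mul_of_nonneg_left (hχ.norm_sub_cut_le f)
    (by positivity)).trans_lt ?_)
  rw [div_mul_eq_mul_div, div_lt_iff₀ (by positivity)]
  nlinarith [norm_nonneg (of.symm f)]

/-- The operator on `C_b(X)` given by a vaguely continuous probability kernel. -/
noncomputable def kernelLM (P : X → ProbabilityMeasure X)
    (hP : ∀ χ : C₀(X, ℝ), Continuous fun z => ∫ x, χ x ∂(P z : Measure X)) :
    StrictCb X →ₗ[ℝ] StrictCb X where
  toFun f := of (BoundedContinuousFunction.ofNormedAddCommGroup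
    (fun z => ∫ x, f x ∂(P z : Measure X)) (continuous_integral_prob hP f) ‖of.symm f‖
    fun z => abs_integral_prob_le (P z) f)
  map_add' f g := by
    ext z
    exact MeasureTheory.integral_add (integrable_prob (P z) f) (integrable_prob (P z) g)
  map_smul' c f := by
    ext z
    exact MeasureTheory.integral_const_mul c _

/-- Families of kernel operators with parameter in a compact set are equicontinuous. -/
theorem exists_seminorm_kernelLM_le {P : Z → X → ProbabilityMeasure X}
    (hP : ∀ χ : C₀(X, ℝ), Continuous fun z : Z × X => ∫ x, χ x ∂(P z.1 z.2 : Measure X))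
    (hP' : ∀ t, ∀ χ : C₀(X, ℝ), Continuous fun z => ∫ x, χ x ∂(P t z : Measure X))
    {A : Set Z} (hA : IsCompact A) (i : Index X) :
    ∃ q : Seminorm ℝ (StrictCb X), Continuous q ∧
      ∀ t ∈ A, ∀ f, strictSeminorm i (kernelLM (P t) (hP' t) f) ≤ q f := by
  have hnorm : ∀ t f, ‖of.symm (kernelLM (P t) (hP' t) f)‖ ≤ ‖of.symm f‖ := fun t f =>
    norm_le (norm_nonneg _) fun z => abs_integral_prob_le (P t z) f
  obtain ⟨C, hC, hiC⟩ := exists_strictSeminorm_le_norm i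
  obtain ⟨q, hq, h⟩ := exists_continuous_seminorm_ge
    (fun t : A => (strictSeminorm i).comp (kernelLM (P t) (hP' t))) hC
    (fun t f => (hiC _).trans (mul_le_mul_of_nonneg_left (hnorm t f) hC)) fun ε hε => by
      -- Tightness is used twice: that of the seminorm reduces to points of `K`, that of the
      -- measures over the compact set `A ×ˢ K` yields `L`.
      obtain ⟨K, B, hB, hK⟩ := exists_isCompact_strictSeminorm_le i (half_pos hε)
      have hδ : 0 < ε / 2 / (B + 1) := by positivity
      obtain ⟨L, hL⟩ := exists_compacts_abs_integral_le hP (hA.prod K.isCompact) hδ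
      refine ⟨L, fun t f hf => ?_⟩
      have h1 := hK (kernelLM (P t) (hP' t) f) (ε / 2 / (B + 1) * ‖of.symm f‖) (by positivity)
        fun z hz => hL (t, z) ⟨t.2, hz⟩ f hf
      have h2 := mul_le_mul_of_nonneg_left (hnorm t f) (half_pos hε).le
      have h3 : B * (ε / 2 / (B + 1)) ≤ ε / 2 := by
        rw [mul_div_assoc', div_le_iff₀ (by positivity)]
        nlinarith
      have h4 := mul_le_mul_of_nonneg_right h3 (norm_nonneg (of.symm f))
      refine h1.trans ?_
      rw [mul_assoc] at h4
      linarith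
  exact ⟨q, hq, fun t ht f => h ⟨t, ht⟩ f⟩

/-- The continuous operator on `C_b(X)` given by a vaguely continuous probability kernel. -/
noncomputable def kernelL (P : X → ProbabilityMeasure X)
    (hP : ∀ χ : C₀(X, ℝ), Continuous fun z => ∫ x, χ x ∂(P z : Measure X)) :
    StrictCb X →L[ℝ] StrictCb X where
  toLinearMap := kernelLM P hP
  cont := by
    refine withSeminorms_strict.continuous_of_continuous_comp _ fun i => ?_
    obtain ⟨q, hq, h⟩ := exists_seminorm_kernelLM_le (Z := Unit) (P := fun _ => P)
      (fun χ => (hP χ).comp continuous_snd) (fun _ => hP) (isCompact_singleton (x := ())) i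
    exact Seminorm.continuous_of_le hq fun f => h () rfl f

end Probability

/-! ### Extension to `C_b(X)` -/

section Semigroup

variable {X : Type*} [TopologicalSpace X]

/-- Local equicontinuity can be tested on the generating seminorms. -/
theorem isLocallyEquicontinuous_of_strictSeminorm {S : ℝ≥0 → StrictCb X →L[ℝ] StrictCb X}
    (h : ∀ (t : ℝ≥0) (i : Index X), ∃ q : Seminorm ℝ (StrictCb X), Continuous q ∧
      ∀ s ≤ t, ∀ f, strictSeminorm i (S s f) ≤ q f) : IsLocallyEquicontinuous S := by
  intro t p hp
  choose q hq hS using h t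
  obtain ⟨s, C, -, hpC⟩ := Seminorm.bound_of_continuous withSeminorms_strict p hp
  have hsum : ∀ f, (∑ i ∈ s, q i : Seminorm ℝ (StrictCb X)) f = ∑ i ∈ s, q i f := fun f => by
    clear hpC
    classical
    induction s using Finset.induction_on with
    | empty => simp
    | insert a s ha ih =>
      rw [Finset.sum_insert ha, Finset.sum_insert ha, ← ih]
      rfl
  have hcont : Continuous (∑ i ∈ s, q i : Seminorm ℝ (StrictCb X)) :=
    (continuous_finsetSum s fun i _ => hq i).congr fun f => (hsum f).symm
  refine ⟨C • ∑ i ∈ s, q i, ?_, fun r hr f => ?_⟩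
  · have : Continuous fun f : StrictCb X => (C : ℝ) * (∑ i ∈ s, q i : Seminorm ℝ (StrictCb X)) f :=
      hcont.const_mul _
    exact this
  · refine (hpC (S r f)).trans (mul_le_mul_of_nonneg_left ?_ C.2)
    refine Seminorm.finset_sup_apply_le (apply_nonneg _ _) fun i hi => (hS i r hr f).trans ?_
    rw [hsum]
    exact Finset.single_le_sum (f := fun i => q i f) (fun j _ => apply_nonneg (q j) f) hi

variable [T2Space X] [LocallyCompactSpace X]

theorem clm_ext_ofC0 {R R' : StrictCb X →L[ℝ] StrictCb X}
    (h : ∀ f : C₀(X, ℝ), R (ofC0 f) = R' (ofC0 f)) : R = R' :=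
  ContinuousLinearMap.ext fun f => congrFun
    (denseRange_ofC0.equalizer R.continuous R'.continuous (funext h)) f

/-- The algebraic laws extend from the dense subspace; equicontinuity extends continuity of orbits
by an `ε/3` argument. -/
theorem isSCLE_of_extends {S : ℝ≥0 → StrictCb X →L[ℝ] StrictCb X}
    {T : ℝ≥0 → C₀(X, ℝ) →L[ℝ] C₀(X, ℝ)} (hT : IsStronglyContinuousSemigroup T)
    (hS : IsLocallyEquicontinuous S) (hST : Extends S T) : IsSCLE S := by
  refine ⟨⟨?_, fun s t => ?_, fun f => ?_⟩, hS⟩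
  · refine clm_ext_ofC0 fun f => ?_
    rw [hST, hT.map_zero]; rfl
  · refine clm_ext_ofC0 fun f => ?_
    rw [ContinuousLinearMap.comp_apply, hST, hST, hST, ← hT.map_add]; rfl
  · rw [continuous_iff_continuousAt]
    intro t
    refine (withSeminorms_strict.tendsto_nhds _ _).2 fun i ε hε => ?_
    have hp := continuous_strictSeminorm i
    obtain ⟨q, hq, hSq⟩ := hS (t + 1) _ hp
    obtain ⟨g, hg⟩ : ∃ g : C₀(X, ℝ), q (ofC0 g - f) < ε / 3 :=
      denseRange_ofC0.exists_mem_open (s := {g | q (g - f) < ε / 3})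
        (isOpen_lt (hq.comp (continuous_id.sub continuous_const)) continuous_const)
        ⟨f, by simp [hε]⟩
    have h1 : Tendsto (fun s => S s (ofC0 g)) (𝓝 t) (𝓝 (S t (ofC0 g))) := by
      simp only [hST _ g]
      exact (continuous_ofC0.comp (hT.continuous_orbit g)).tendsto t
    filter_upwards [gt_mem_nhds (show t < t + 1 by simp),
      (tendsto_iff_seminorm.1 h1 _ hp).eventually (gt_mem_nhds (show 0 < ε / 3 by positivity))]
      with s hs h2
    have h3 := (hSq s hs.le (ofC0 g - f)).trans_lt hg
    have h4 := (hSq t (by simp) (ofC0 g - f)).trans_lt hg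
    have h5 : S s f - S t f = (S s (ofC0 g) - S t (ofC0 g)) - S s (ofC0 g - f)
        + S t (ofC0 g - f) := by
      rw [map_sub, map_sub]; abel
    have h6 : strictSeminorm i (S s f - S t f) < ε := by
      rw [h5]
      have h7 := map_add_le_add (strictSeminorm i) ((S s (ofC0 g) - S t (ofC0 g))
        - S s (ofC0 g - f)) (S t (ofC0 g - f))
      have h8 := map_sub_le_add (strictSeminorm i) (S s (ofC0 g) - S t (ofC0 g))
        (S s (ofC0 g - f))
      linarith
    exact h6

end Semigroup

theorem existsUnique_extension {X : Type*} [TopologicalSpace X] [PolishSpace X]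
    [LocallyCompactSpace X] [MeasurableSpace X] [BorelSpace X] {T : ℝ≥0 → C₀(X, ℝ) →L[ℝ] C₀(X, ℝ)}
    (hT : IsStronglyContinuousSemigroup T) (hTP : AdjointPreservesProbability T) :
    ∃! S : ℝ≥0 → StrictCb X →L[ℝ] StrictCb X, IsSCLE S ∧ Extends S T := by
  have hex : ∀ (t : ℝ≥0) (x : X), ∃ μ : ProbabilityMeasure X,
      ∀ f : C₀(X, ℝ), T t f x = ∫ y, f y ∂(μ : Measure X) := fun t x => by
    let φ : StrongDual ℝ C₀(X, ℝ) := (evalL x).comp ⟨ofC0, continuous_ofC0⟩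
    have hφ : φ ∈ probabilityFunctionals X := ⟨⟨Measure.dirac x, inferInstance⟩, fun f =>
      (integral_dirac (f : X → ℝ) x).symm⟩
    exact hTP t hφ
  choose P hP using hex
  have hjoint : ∀ χ : C₀(X, ℝ), Continuous fun z : ℝ≥0 × X =>
      -- Joint continuity in time and space comes from the norm-continuous orbit of `χ`, seen as a
      -- strictly continuous curve.
      ∫ x, χ x ∂(P z.1 z.2 : Measure X) := fun χ => by
    have h1 := continuous_uncurry ⟨fun s : ℝ => ofC0 (T s.toNNReal χ),
      continuous_ofC0.comp ((hT.continuous_orbit χ).comp continuous_real_toNNReal)⟩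
    have h2 := h1.comp ((NNReal.continuous_coe.comp continuous_fst).prodMk continuous_snd :
      Continuous fun z : ℝ≥0 × X => ((z.1 : ℝ), z.2))
    refine h2.congr fun z => ?_
    simp [← hP]
  have hx : ∀ t, ∀ χ : C₀(X, ℝ), Continuous fun x => ∫ y, χ y ∂(P t x : Measure X) :=
    fun t χ => (hjoint χ).comp (Continuous.prodMk_right t)
  have hext : Extends (fun t => kernelL (P t) (hx t)) T := fun t f => by
    ext x
    exact (hP t x f).symm
  have hequi : IsLocallyEquicontinuous fun t => kernelL (P t) (hx t) :=
    isLocallyEquicontinuous_of_strictSeminorm fun t i => by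
      obtain ⟨q, hq, h⟩ := exists_seminorm_kernelLM_le hjoint hx (isCompact_Icc (a := 0) (b := t)) i
      exact ⟨q, hq, fun s hs f => h s ⟨zero_le, hs⟩ f⟩
  exact ⟨_, ⟨isSCLE_of_extends hT hequi hext, hext⟩, fun S hS => funext fun t =>
    clm_ext_ofC0 fun f => by rw [hS.2, hext]⟩

end StrictCb

/-! ### The generator as the closure of the generator on `C_0(X)` -/

/-- Integrals of orbits of a strongly continuous semigroup lie in the domain of the generator. -/
theorem integral_orbit_mem_generator {E : Type*} [NormedAddCommGroup E] [NormedSpace ℝ E]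
    [CompleteSpace E] {T : ℝ≥0 → E →L[ℝ] E} (hT : IsStronglyContinuousSemigroup T) (h : ℝ≥0)
    (f : E) : (∫ s in (0 : ℝ)..h, T s.toNNReal f, T h f - f) ∈ generator T := by
  have hc : Continuous fun s : ℝ => T s.toNNReal f :=
    (hT.continuous_orbit f).comp continuous_real_toNNReal
  have hi : ∀ a b : ℝ, IntervalIntegrable (fun s : ℝ => T s.toNNReal f) volume a b :=
    fun a b => hc.intervalIntegrable a b
  have hder : ∀ a : ℝ, Tendsto (fun t : ℝ≥0 => (t : ℝ)⁻¹ • ∫ s in a..(a + t), T s.toNNReal f)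
      (𝓝[>] 0) (𝓝 (T a.toNNReal f)) := fun a => by
    have h1 := (intervalIntegral.integral_hasDerivAt_right (hi a a)
      hc.stronglyMeasurable.stronglyMeasurableAtFilter hc.continuousAt).tendsto_slope_zero_right
    have h2 : Tendsto (fun t : ℝ≥0 => (t : ℝ)) (𝓝[>] 0) (𝓝[>] (0 : ℝ)) := by
      refine tendsto_nhdsWithin_iff.2 ⟨?_, ?_⟩
      · exact (NNReal.continuous_coe.tendsto 0).mono_left nhdsWithin_le_nhds
      · filter_upwards [self_mem_nhdsWithin] with t ht
        exact NNReal.coe_pos.2 ht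
    simpa [Function.comp_def] using h1.comp h2
  -- `T t - 1` applied to the integral over `[0, h]` leaves the integral over `[h, h + t]` minus
  -- that over `[0, t]`: differentiation at the two endpoints.
  have h3 := (hder h).sub (hder 0)
  rw [Real.toNNReal_coe, Real.toNNReal_zero, hT.map_zero, ContinuousLinearMap.id_apply] at h3
  refine h3.congr fun t => ?_
  rw [← smul_sub]
  congr 1
  have h4 : T t (∫ s in (0 : ℝ)..h, T s.toNNReal f) = ∫ s in (t : ℝ)..(h + t), T s.toNNReal f := by
    rw [← ContinuousLinearMap.intervalIntegral_comp_comm _ (hi _ _)]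
    have h5 := intervalIntegral.integral_comp_add_right (a := 0) (b := (h : ℝ))
      (fun s : ℝ => T s.toNNReal f) (t : ℝ)
    rw [zero_add] at h5
    rw [← h5]
    refine intervalIntegral.integral_congr fun s hs => ?_
    rw [uIcc_of_le h.coe_nonneg] at hs
    rw [Real.toNNReal_add hs.1 t.coe_nonneg, Real.toNNReal_coe, add_comm, ← hT.map_add]
    rfl
  simp only [h4, zero_add]
  have e1 := intervalIntegral.integral_add_adjacent_intervals (hi 0 t) (hi t (h + t))
  have e2 := intervalIntegral.integral_add_adjacent_intervals (hi 0 h) (hi h (h + t))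
  rw [sub_eq_sub_iff_add_eq_add]
  exact (add_comm _ _).trans (e2.trans (e1.symm.trans (add_comm _ _)))

namespace StrictCb

variable {X : Type*} [TopologicalSpace X] {S : ℝ≥0 → StrictCb X →L[ℝ] StrictCb X}
  {T : ℝ≥0 → C₀(X, ℝ) →L[ℝ] C₀(X, ℝ)}

theorem c0Generator_subset_generator (hST : Extends S T) : c0Generator T ⊆ generator S := by
  rintro _ ⟨z, hz, rfl⟩
  refine ((continuous_ofC0.tendsto _).comp hz).congr fun t => ?_
  simp [hST t z.1]

variable [LocallyCompactSpace X]

/-- Links the Bochner integral in `C_0(X)`, used for the generator of `T`, with the pointwise strict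
integral; point evaluations commute with both. -/
theorem ofC0_integral (hS : IsSCLE S) (hT : IsStronglyContinuousSemigroup T) (hST : Extends S T)
    (h : ℝ≥0) (f : C₀(X, ℝ)) :
    ofC0 (∫ s in (0 : ℝ)..h, T s.toNNReal f) = orbitIntegral hS h (ofC0 f) := by
  ext x
  let φ : StrongDual ℝ C₀(X, ℝ) := (evalL x).comp ⟨ofC0, continuous_ofC0⟩
  have h1 := φ.intervalIntegral_comp_comm (((hT.continuous_orbit f).comp
    continuous_real_toNNReal).intervalIntegrable (μ := volume) 0 h)
  refine h1.symm.trans ?_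
  rw [orbitIntegral_eq, integral_apply]
  refine intervalIntegral.integral_congr fun s _ => ?_
  exact (congrArg (fun g : StrictCb X => g x) (hST s.toNNReal f)).symm

theorem generator_eq_closure [T2Space X] (hS : IsSCLE S) (hT : IsStronglyContinuousSemigroup T)
    (hST : Extends S T) : generator S = closure (c0Generator T) := by
  refine Subset.antisymm (fun z hz => ?_)
    (closure_minimal (c0Generator_subset_generator hST) (isClosed_generator hS))
  -- For `f` in `C_0(X)` the pair is in the graph itself; strict continuity of `orbitIntegral hS t`
  -- and `S t` carries it to every `f`, so no resolvent is needed.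
  have hmem : ∀ (t : ℝ≥0) (f : StrictCb X),
      (orbitIntegral hS t f, S t f - f) ∈ closure (c0Generator T) := fun t f => by
    have hcont : Continuous fun f : StrictCb X => (orbitIntegral hS t f, S t f - f) :=
      (orbitIntegral hS t).continuous.prodMk ((S t).continuous.sub continuous_id)
    refine map_mem_closure (f := fun f => (orbitIntegral hS t f, S t f - f)) hcont
      (denseRange_ofC0 f) ?_
    rintro _ ⟨g, rfl⟩
    refine ⟨_, integral_orbit_mem_generator hT t g, ?_⟩
    rw [Prod.map_apply, ofC0_integral hS hT hST, map_sub, ← hST]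
  have hsmul : ∀ (c : ℝ) (w : StrictCb X × StrictCb X), w ∈ closure (c0Generator T) →
      c • w ∈ closure (c0Generator T) := fun c w hw => by
    refine map_mem_closure (continuous_const_smul c) hw ?_
    rintro _ ⟨v, hv, rfl⟩
    refine ⟨c • v, ?_, by simp [Prod.map]⟩
    refine (Tendsto.const_smul hv c).congr fun t => ?_
    rw [Prod.smul_fst, map_smul]
    exact (smul_comm c (t : ℝ)⁻¹ (T t v.1 - v.1)).trans
      (congrArg ((t : ℝ)⁻¹ • ·) (smul_sub c (T t v.1) v.1))
  have hlim : Tendsto (fun t : ℝ≥0 => ((t : ℝ)⁻¹ • orbitIntegral hS t z.1,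
      (t : ℝ)⁻¹ • (S t z.1 - z.1))) (𝓝[>] 0) (𝓝 (z.1, z.2)) :=
    (tendsto_inv_smul_orbitIntegral hS z.1).prodMk_nhds hz
  exact isClosed_closure.mem_of_tendsto hlim
    (Eventually.of_forall fun t => hsmul (t : ℝ)⁻¹ _ (hmem t z.1))

end StrictCb

theorem mainTheorem2 {X : Type*} [TopologicalSpace X] [PolishSpace X] [LocallyCompactSpace X]
    [MeasurableSpace X] [BorelSpace X] :
    -- restriction from `C_b(X)` to `C_0(X)`
    (∀ S : ℝ≥0 → StrictCb X →L[ℝ] StrictCb X, IsSCLE S →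
      (∀ t : ℝ≥0, MapsTo (S t) (range StrictCb.ofC0) (range StrictCb.ofC0)) →
      ∃ T : ℝ≥0 → C₀(X, ℝ) →L[ℝ] C₀(X, ℝ), Extends S T ∧ IsStronglyContinuousSemigroup T) ∧
    -- unique extension from `C_0(X)` to `C_b(X)`
    (∀ T : ℝ≥0 → C₀(X, ℝ) →L[ℝ] C₀(X, ℝ), IsStronglyContinuousSemigroup T →
      AdjointPreservesProbability T →
      ∃! S : ℝ≥0 → StrictCb X →L[ℝ] StrictCb X, IsSCLE S ∧ Extends S T) ∧
    -- the generators, in either of the two situations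
    (∀ (S : ℝ≥0 → StrictCb X →L[ℝ] StrictCb X) (T : ℝ≥0 → C₀(X, ℝ) →L[ℝ] C₀(X, ℝ)),
      IsSCLE S → IsStronglyContinuousSemigroup T → Extends S T →
      c0Generator T ⊆ generator S ∧ generator S = closure (c0Generator T)) := by
  refine ⟨fun S hS hmaps => ?_, fun T hT hTP => StrictCb.existsUnique_extension hT hTP,
    fun S T hS hT hST => ⟨StrictCb.c0Generator_subset_generator hST,
      StrictCb.generator_eq_closure hS hT hST⟩⟩
  obtain ⟨T, hST⟩ := StrictCb.exists_restriction hS hmaps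
  exact ⟨T, hST, StrictCb.isStronglyContinuousSemigroup_of_extends hS hST⟩
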